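/- **Theorem.** Let $s\in(0,1)$, let $n\in\mathbb N$ with $n>4s$, and set $\beta:=\frac{2n}{n+2s}$, $2^*_s:=\frac{2n}{n-2s}$. All functions are real-valued on $\mathbb R^n$. Write $$[u]_{\dot H^s}:=\Big(\iint_{\mathbb R^{2n}}\frac{|u(x)-u(y)|^2}{|x-y|^{n+2s}}\,dx\,dy\Big)^{1/2},$$ let $\dot H^s(\mathbb R^n)$ be the completion of the Schwartz space with respect to the norm $[u]_{\dot H^s}+\|u\|_{L^{2^*_s}(\mathbb R^n)}$ (that is, the set of all $u\in L^{2^*_s}(\mathbb R^n)$ that are limits of Schwartz functions in this norm), and let $X^s:=\dot H^s(\mathbb R^n)\cap L^\infty(\mathbb R^n)$. There are constants $C,c>0$ depending only on $n$ and $s$ and, for every $\delta>0$, a constant $C_\delta>0$ depending only on $n$, $s$ and $\delta$, such that for every $\psi\in L^\beta(\mathbb R^n)$ the Riesz potential $$J\psi(x):=\int_{\mathbb R^n}\frac{\psi(y)}{|x-y|^{n-2s}}\,dy$$ converges absolutely for a.e. $x\in\mathbb R^n$, and the following hold. 1. $J\psi\in L^{2^*_s}(\mathbb R^n)$ and $\|J\psi\|_{L^{2^*_s}(\mathbb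 R^n)}\le C\,\|\psi\|_{L^\beta(\mathbb R^n)}$. 2. $J\psi\in\dot H^s(\mathbb R^n)$ and $[J\psi]_{\dot H^s}\le C\,\|\psi\|_{L^\beta(\mathbb R^n)}$. 3. $(-\Delta)^s(J\psi)=c\,\psi$ in the weak sense: for every $\phi\in X^s$, $$\iint_{\mathbb R^{2n}}\frac{\big(J\psi(x)-J\psi(y)\big)\big(\phi(x)-\phi(y)\big)}{|x-y|^{n+2s}}\,dx\,dy=c\int_{\mathbb R^n}\psi(x)\,\phi(x)\,dx,$$ where both integrals converge absolutely. 4. If in addition, for some $\delta>0$, $\psi$ is in $L^{\frac n{2s}+\delta}$ of unit balls, uniformly with respect to the centre, i.e. $$M_\delta(\psi):=\sup_{z\in\mathbb R^n}\|\psi\|_{L^{\frac n{2s}+\delta}(B_1(z))}<\infty,\qquad B_1(z):=\{y\in\mathbb R^n:|y-z|<1\},$$ then $J\psi\in L^\infty(\mathbb R^n)$ and $\|J\psi\|_{L^\infty(\mathbb R^n)}\le C_\delta\big(M_\delta(\psi)+\|\psi\|_{L^\beta(\mathbb R^n)}\big)$. 5. In particular, if $\psi\in L^\beta(\mathbb R^n)\cap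 L^\infty(\mathbb R^n)$, then $J\psi\in L^\infty(\mathbb R^n)$ and $\|J\psi\|_{L^\infty(\mathbb R^n)}\le C\big(\|\psi\|_{L^\infty(\mathbb R^n)}+\|\psi\|_{L^\beta(\mathbb R^n)}\big)$. -/

import Mathlib

open MeasureTheory Filter Topology
open scoped ENNReal

namespace FracRiesz

/-- Euclidean space of dimension `n`, with the Euclidean norm and Lebesgue measure. -/
abbrev Rn (n : ℕ) : Type := EuclideanSpace ℝ (Fin n)

/-- The exponent `β = 2n / (n + 2s)`. -/
noncomputable def betaExp (n : ℕ) (s : ℝ) : ℝ≥0∞ :=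
  ENNReal.ofReal (2 * (n : ℝ) / ((n : ℝ) + 2 * s))

/-- The fractional critical Sobolev exponent `2n / (n - 2s)`. -/
noncomputable def critExp (n : ℕ) (s : ℝ) : ℝ≥0∞ :=
  ENNReal.ofReal (2 * (n : ℝ) / ((n : ℝ) - 2 * s))

/-- The integrand `ψ(y) / |x - y| ^ (n - 2s)` of the Riesz potential. -/
noncomputable def rieszIntegrand {n : ℕ} (s : ℝ) (ψ : Rn n → ℝ) (x y : Rn n) : ℝ :=
  ψ y / ‖x - y‖ ^ ((n : ℝ) - 2 * s)

/-- The Riesz potential `Jψ(x) = ∫ ψ(y) / |x - y| ^ (n - 2s) dy`. -/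
noncomputable def rieszJ {n : ℕ} (s : ℝ) (ψ : Rn n → ℝ) (x : Rn n) : ℝ :=
  ∫ y, rieszIntegrand s ψ x y

/-- The Gagliardo seminorm
`(∬ |u(x) - u(y)| ^ 2 / |x - y| ^ (n + 2s) dx dy) ^ (1 / 2)`, with values in `[0, ∞]`. -/
noncomputable def gagliardo {n : ℕ} (s : ℝ) (u : Rn n → ℝ) : ℝ≥0∞ :=
  (∫⁻ p : Rn n × Rn n,
    ENNReal.ofReal (|u p.1 - u p.2| ^ 2 / ‖p.1 - p.2‖ ^ ((n : ℝ) + 2 * s))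
      ∂(volume.prod volume)) ^ (1 / 2 : ℝ)

/-- Membership in the homogeneous space: the completion of the Schwartz functions for the norm
`gagliardo + ‖·‖_{L^{2n/(n-2s)}}`, realized inside `L^{2n/(n-2s)}` as the set of the functions
that are limits of Schwartz functions for this norm. -/
def MemHdot {n : ℕ} (s : ℝ) (u : Rn n → ℝ) : Prop :=
  MemLp u (critExp n s) volume ∧
    ∃ f : ℕ → SchwartzMap (Rn n) ℝ,
      Tendsto (fun k => gagliardo s (fun x => u x - f k x)
        + eLpNorm (fun x => u x - f k x) (critExp n s) volume) atTop (𝓝 0)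

/-- Membership in the test space `X^s`, the bounded functions of the homogeneous space. -/
def MemX {n : ℕ} (s : ℝ) (u : Rn n → ℝ) : Prop :=
  MemHdot s u ∧ MemLp u ⊤ volume

/-- The integrand of the bilinear form of the Gagliardo seminorm. -/
noncomputable def formIntegrand {n : ℕ} (s : ℝ) (u φ : Rn n → ℝ) (p : Rn n × Rn n) : ℝ :=
  (u p.1 - u p.2) * (φ p.1 - φ p.2) / ‖p.1 - p.2‖ ^ ((n : ℝ) + 2 * s)

/-- `(-Δ)^s u = f` weakly, tested against `X^s`; both integrals converge absolutely. -/
def WeaklySolves {n : ℕ} (s : ℝ) (u f : Rn n → ℝ) : Prop :=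
  ∀ φ : Rn n → ℝ, MemX s φ →
    Integrable (formIntegrand s u φ) (volume.prod volume) ∧
    Integrable (fun x => f x * φ x) volume ∧
    ∫ p, formIntegrand s u φ p ∂(volume.prod volume) = ∫ x, f x * φ x

/-- The uniformly local norm `sup_z ‖ψ‖_{L^r(B_1(z))}` over the open unit balls. -/
noncomputable def unifLocNorm {n : ℕ} (r : ℝ≥0∞) (ψ : Rn n → ℝ) : ℝ≥0∞ :=
  ⨆ z : Rn n, eLpNorm ψ r (volume.restrict (Metric.ball z 1))

end FracRiesz

/-!
The proof rests on three facts about the potential `J`.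

*The Hardy–Littlewood–Sobolev inequality for the dual pair `(β, 2*)`.* By duality it is a bound for
`∬ g(x) f(y) |x - y| ^ (2s - n)` with `f`, `g` of unit norm in `L^β`. Split the domain into
`{f(y) ≤ g(x)}` and its complement. For fixed `x` the integral of `f(y) |x - y| ^ (2s - n)` over
`{f ≤ t}` is at most `C t ^ (β - 1)`: near `x` use `f ≤ t`, far from `x` use Hölder, and balance at
the radius `t ^ (-β/n)`. With `t = g(x)` this leaves `∫ g ^ β`. No maximal function is needed, since
both exponents equal `β` (`exists_setLIntegral_le_rpow`, `exists_lintegral_mul_rieszPot_le`,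
`exists_lintegral_rieszPot_rpow_le`). Hölder on a unit ball and on its complement gives the `L^∞`
bound (`exists_rieszPot_le_unifLocNorm`).

*The weak equation for test functions* `ψ`, `φ`. Integrating first in `x` for fixed `h = y - x`
turns the form into `∫ |h| ^ (-n-2s) (2 A(0) - A(h) - A(-h)) dh`, where
`A(h) = ∫ Jψ(x) φ(x + h) dx = ∫ |w| ^ (2s-n) g(w + h) dw` and `g` is the cross-correlation of `ψ`
and `φ`. Writing both `|w| ^ (2s-n)` and `|ξ| ^ (-2s)` as superpositions of Gaussians gives
`A(h) = c₂ ∫ |ξ| ^ (-2s) ĝ(ξ) e ^ (2πi⟨h, ξ⟩) dξ` (`exists_integral_rpow_mul_eq`), and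
`∫ |h| ^ (-n-2s) (2 - 2 cos 2π⟨h, ξ⟩) dh = c₁ |ξ| ^ (2s)` (`exists_integral_symbolIntegrand`). The
powers of `|ξ|` cancel, and `∫ ĝ = g(0) = ∫ ψ φ` remains (`exists_integral_formIntegrand_rieszJ`).

*Density.* For a test function `ψ`, the potential `Jψ` is smooth and decays like `|x| ^ (2s-n)`,
with difference quotients that decay at the same rate; because `n > 4s` it lies in `L²`, and
therefore its truncations converge to it in the Gagliardo seminorm (`tendsto_gagliardo_cutoff`). So
`Jψ` may be used as a test function, and `[Jψ]² = c ∫ ψ Jψ ≤ C ‖ψ‖_β²`. Fatou's lemma extends this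
bound to all `ψ ∈ L^β` (`exists_gagliardo_rieszJ_le`); by linearity and density so do the membership
of `Jψ` in the homogeneous space (`hdotApprox_rieszJ`) and the weak equation
(`integral_formIntegrand_rieszJ`).
-/

namespace FracRiesz

open scoped ContDiff FourierTransform Convolution

variable {n : ℕ}

/-! ### Power kernels -/

/-- The kernel `|z| ^ (-a)` with values in `[0, ∞]`; at the origin it takes the junk value `0`
when `a ≠ 0`, which does not affect integrals. -/
noncomputable def powKernel (a : ℝ) (z : Rn n) : ℝ≥0∞ := ENNReal.ofReal (‖z‖ ^ (-a))

@[fun_prop]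
lemma measurable_powKernel (a : ℝ) : Measurable (powKernel a : Rn n → ℝ≥0∞) := by
  unfold powKernel; fun_prop

lemma powKernel_sub_comm (a : ℝ) (x y : Rn n) : powKernel a (x - y) = powKernel a (y - x) := by
  simp only [powKernel, norm_sub_rev]

lemma powKernel_smul (a : ℝ) {R : ℝ} (hR : 0 < R) (z : Rn n) :
    powKernel a (R • z) = ENNReal.ofReal (R ^ (-a)) * powKernel a z := by
  rw [powKernel, powKernel, ← ENNReal.ofReal_mul (by positivity), norm_smul, Real.norm_eq_abs,
    abs_of_pos hR, Real.mul_rpow hR.le (norm_nonneg _)]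

lemma lintegral_comp_smul (f : Rn n → ℝ≥0∞) {R : ℝ} (hR : 0 < R) :
    ∫⁻ x, f x = ENNReal.ofReal (R ^ (n : ℝ)) * ∫⁻ x, f (R • x) := by
  have h : ∫⁻ x, f (R • x) = ∫⁻ y, f y ∂Measure.map (fun x : Rn n => R • x) volume :=
    (lintegral_map_equiv f
      (Homeomorph.smul (isUnit_iff_ne_zero.2 hR.ne').unit).toMeasurableEquiv).symm
  rw [h, Measure.map_addHaar_smul volume hR.ne', lintegral_smul_measure, smul_eq_mul, ← mul_assoc,
    ← ENNReal.ofReal_mul (by positivity), abs_of_pos (by positivity), finrank_euclideanSpace,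
    Fintype.card_fin, Real.rpow_natCast, mul_inv_cancel₀ (by positivity), ENNReal.ofReal_one,
    one_mul]

lemma setLIntegral_powKernel_smul {a R : ℝ} (hR : 0 < R) {S T : Set (Rn n)}
    (hS : MeasurableSet S) (hT : MeasurableSet T) (hST : ∀ x, R • x ∈ S ↔ x ∈ T) :
    ∫⁻ z in S, powKernel a z = ENNReal.ofReal (R ^ ((n : ℝ) - a)) * ∫⁻ z in T, powKernel a z := by
  rw [← lintegral_indicator hS, ← lintegral_indicator hT, lintegral_comp_smul _ hR, sub_eq_add_neg,
    Real.rpow_add hR, ENNReal.ofReal_mul (by positivity), mul_assoc]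
  congr 1
  rw [← lintegral_const_mul _ ((measurable_powKernel a).indicator hT)]
  refine lintegral_congr fun x => ?_
  by_cases hx : x ∈ T
  · rw [Set.indicator_of_mem hx, Set.indicator_of_mem ((hST x).2 hx), powKernel_smul a hR]
  · rw [Set.indicator_of_notMem hx, Set.indicator_of_notMem (fun h => hx ((hST x).1 h)), mul_zero]

lemma setLIntegral_powKernel_ball (a : ℝ) {R : ℝ} (hR : 0 < R) :
    ∫⁻ z in Metric.ball (0 : Rn n) R, powKernel a z
      = ENNReal.ofReal (R ^ ((n : ℝ) - a)) * ∫⁻ z in Metric.ball (0 : Rn n) 1, powKernel a z := by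
  refine setLIntegral_powKernel_smul hR measurableSet_ball measurableSet_ball fun x => ?_
  simp [norm_smul, abs_of_pos hR, hR]

lemma setLIntegral_powKernel_compl_ball (a : ℝ) {R : ℝ} (hR : 0 < R) :
    ∫⁻ z in (Metric.ball (0 : Rn n) R)ᶜ, powKernel a z
      = ENNReal.ofReal (R ^ ((n : ℝ) - a)) * ∫⁻ z in (Metric.ball (0 : Rn n) 1)ᶜ, powKernel a z := by
  refine setLIntegral_powKernel_smul hR measurableSet_ball.compl measurableSet_ball.compl fun x => ?_
  simp [norm_smul, abs_of_pos hR, hR]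

lemma integrableOn_ball_norm_rpow [NeZero n] {a : ℝ} (ha : a < n) (R : ℝ) :
    IntegrableOn (fun z : Rn n => ‖z‖ ^ (-a)) (Metric.ball 0 R) := by
  rcases le_or_gt R 0 with hR | hR
  · simp [Metric.ball_eq_empty.2 hR]
  have hn : 1 ≤ n := NeZero.one_le
  rw [integrableOn_fun_norm_addHaar volume (f := fun r => r ^ (-a)), finrank_euclideanSpace,
    Fintype.card_fin]
  have h := (intervalIntegral.integrableOn_Ioo_rpow_iff (s := (n : ℝ) - 1 - a) hR).2 (by linarith)
  refine h.congr_fun (fun y hy => ?_) measurableSet_Ioo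
  have hy0 : 0 < y := hy.1
  simp only [smul_eq_mul]
  rw [← Real.rpow_natCast, ← Real.rpow_add hy0, Nat.cast_sub hn]
  congr 1
  push_cast
  ring

lemma setLIntegral_powKernel_ball_lt_top [NeZero n] {a : ℝ} (ha : a < n) (R : ℝ) :
    ∫⁻ z in Metric.ball (0 : Rn n) R, powKernel a z < ⊤ :=
  (integrableOn_ball_norm_rpow ha R).lintegral_lt_top

lemma setLIntegral_powKernel_compl_ball_lt_top {a : ℝ} (ha : (n : ℝ) < a) :
    ∫⁻ z in (Metric.ball (0 : Rn n) 1)ᶜ, powKernel a z < ⊤ := by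
  have ha0 : 0 < a := lt_of_le_of_lt (Nat.cast_nonneg n) ha
  have h : Integrable (fun z : Rn n => 2 ^ a * (1 + ‖z‖) ^ (-a)) :=
    (integrable_one_add_norm (by simpa using ha)).const_mul _
  refine lt_of_le_of_lt ?_ h.lintegral_lt_top
  refine (setLIntegral_mono' (g := fun z : Rn n => ENNReal.ofReal (2 ^ a * (1 + ‖z‖) ^ (-a)))
    measurableSet_ball.compl fun z hz => ENNReal.ofReal_le_ofReal ?_).trans
    (setLIntegral_le_lintegral _ _)
  have hz1 : 1 ≤ ‖z‖ := by simpa using hz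
  have hz0 : 0 < ‖z‖ := by linarith
  calc ‖z‖ ^ (-a) = 2 ^ a * (2 * ‖z‖) ^ (-a) := by
        rw [Real.mul_rpow (by norm_num) hz0.le, ← mul_assoc, ← Real.rpow_add (by norm_num)]
        simp
    _ ≤ _ := by
        gcongr 2 ^ a * ?_
        exact Real.rpow_le_rpow_of_nonpos (by positivity) (by linarith) (by linarith)

/-! ### The Hardy–Littlewood–Sobolev inequality on the dual pair `(β, 2*)` -/

/-- The Riesz potential of a nonnegative function, with values in `[0, ∞]`. -/
noncomputable def rieszPot (s : ℝ) (f : Rn n → ℝ≥0∞) (x : Rn n) : ℝ≥0∞ :=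
  ∫⁻ y, f y * powKernel ((n : ℝ) - 2 * s) (x - y)

lemma measurable_rieszPot {s : ℝ} {f : Rn n → ℝ≥0∞} (hf : Measurable f) :
    Measurable (rieszPot s f) := by
  unfold rieszPot
  exact Measurable.lintegral_prod_right' (f := fun p : Rn n × Rn n =>
    f p.2 * powKernel ((n : ℝ) - 2 * s) (p.1 - p.2)) (by fun_prop)

/-- The real exponent `2n / (n + 2s)`. -/
noncomputable def bExp (n : ℕ) (s : ℝ) : ℝ := 2 * (n : ℝ) / ((n : ℝ) + 2 * s)

/-- The real exponent `2n / (n - 2s)`, conjugate to `bExp`. -/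
noncomputable def qExp (n : ℕ) (s : ℝ) : ℝ := 2 * (n : ℝ) / ((n : ℝ) - 2 * s)

lemma holderConjugate_bExp_qExp {s : ℝ} (hs : 0 < s) (hn : 2 * s < n) :
    (bExp n s).HolderConjugate (qExp n s) := by
  rw [Real.holderConjugate_iff, bExp, qExp]
  have h1 : 0 < (n : ℝ) - 2 * s := by linarith
  have h2 : 0 < (n : ℝ) + 2 * s := by linarith
  have h3 : 0 < (n : ℝ) := by linarith
  refine ⟨by rw [one_lt_div h2]; linarith, ?_⟩
  field_simp
  ring

lemma setLIntegral_sub_left (f : Rn n → ℝ≥0∞) (x : Rn n) (S : Set (Rn n))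
    (hS : MeasurableSet S) :
    ∫⁻ y in {y | x - y ∈ S}, f (x - y) = ∫⁻ z in S, f z := by
  have hm : MeasurableSet {y | x - y ∈ S} := (measurable_const.sub measurable_id) hS
  rw [← lintegral_indicator hm, ← lintegral_indicator hS,
    ← lintegral_sub_left_eq_self (S.indicator f) x]
  rfl

/-- Splitting the potential of the part of `f` below the level `t` at the radius `t ^ (-β/n)`
balances the local part, bounded by the level, against the tail, bounded by Hölder. -/
lemma exists_setLIntegral_le_rpow [NeZero n] {s : ℝ} (hs : 0 < s) (hn : 2 * s < n) :
    ∃ C : ℝ≥0∞, C ≠ ⊤ ∧ ∀ f : Rn n → ℝ≥0∞, Measurable f → ∫⁻ y, f y ^ bExp n s ≤ 1 →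
      ∀ t : ℝ, 0 < t → ∀ x : Rn n,
        ∫⁻ y in {y | f y ≤ ENNReal.ofReal t}, f y * powKernel ((n : ℝ) - 2 * s) (x - y)
          ≤ C * ENNReal.ofReal (t ^ (bExp n s - 1)) := by
  have hpq := holderConjugate_bExp_qExp hs hn
  have hb : bExp n s = 2 * (n : ℝ) / ((n : ℝ) + 2 * s) := rfl
  have hq : qExp n s = 2 * (n : ℝ) / ((n : ℝ) - 2 * s) := rfl
  set b := bExp n s
  set q := qExp n s
  have h1 : 0 < (n : ℝ) - 2 * s := by linarith
  have h2 : 0 < (n : ℝ) + 2 * s := by linarith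
  have h3 : 0 < (n : ℝ) := by linarith
  have hq0 : 0 < q := hpq.symm.pos
  set a := (n : ℝ) - 2 * s with ha
  set A := ∫⁻ z in Metric.ball (0 : Rn n) 1, powKernel a z with hA
  set B := ∫⁻ z in (Metric.ball (0 : Rn n) 1)ᶜ, powKernel (2 * n) z with hB
  have hAt : A ≠ ⊤ := (setLIntegral_powKernel_ball_lt_top (by linarith) 1).ne
  have hBt : B ≠ ⊤ := (setLIntegral_powKernel_compl_ball_lt_top (by linarith)).ne
  refine ⟨A + B ^ (1 / q), by finiteness, ?_⟩
  intro f hf hf1 t ht x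
  set ρ : ℝ := t ^ (-(b / n)) with hρ
  have hρ0 : 0 < ρ := Real.rpow_pos_of_pos ht _
  set U : Set (Rn n) := {y | x - y ∈ Metric.ball (0 : Rn n) ρ} with hU
  have hUm : MeasurableSet U := (measurable_const.sub measurable_id) measurableSet_ball
  have hUc : Uᶜ = {y | x - y ∈ (Metric.ball (0 : Rn n) ρ)ᶜ} := rfl
  set S : Set (Rn n) := {y | f y ≤ ENNReal.ofReal t}
  have hSm : MeasurableSet S := measurableSet_le hf measurable_const
  rw [← lintegral_inter_add_sdiff _ S hUm, add_mul]
  refine add_le_add ?_ ?_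
  · calc ∫⁻ y in S ∩ U, f y * powKernel a (x - y)
        ≤ ∫⁻ y in S ∩ U, ENNReal.ofReal t * powKernel a (x - y) :=
          setLIntegral_mono' (hSm.inter hUm) fun y hy => by gcongr; exact hy.1
      _ ≤ ∫⁻ y in U, ENNReal.ofReal t * powKernel a (x - y) :=
          lintegral_mono_set Set.inter_subset_right
      _ = ENNReal.ofReal t * (ENNReal.ofReal (ρ ^ ((n : ℝ) - a)) * A) := by
          rw [lintegral_const_mul _ (by fun_prop), setLIntegral_sub_left (powKernel a) x _
            measurableSet_ball, setLIntegral_powKernel_ball a hρ0]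
      _ = A * ENNReal.ofReal (t ^ (b - 1)) := by
          rw [← mul_assoc, mul_comm, ← ENNReal.ofReal_mul ht.le, hρ, ← Real.rpow_mul ht.le]
          congr 2
          nth_rw 1 [← Real.rpow_one t]
          rw [← Real.rpow_add ht]
          congr 1
          rw [hb, ha]
          field_simp
          ring
  · calc ∫⁻ y in S \ U, f y * powKernel a (x - y)
        ≤ ∫⁻ y in Uᶜ, f y * powKernel a (x - y) :=
          lintegral_mono_set fun y hy => hy.2
      _ ≤ (∫⁻ y in Uᶜ, f y ^ b) ^ (1 / b) * (∫⁻ y in Uᶜ, powKernel a (x - y) ^ q) ^ (1 / q) :=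
          ENNReal.lintegral_mul_le_Lp_mul_Lq _ hpq hf.aemeasurable (by fun_prop)
      _ ≤ 1 * (ENNReal.ofReal (ρ ^ ((n : ℝ) - 2 * n)) * B) ^ (1 / q) := by
          gcongr
          · refine ENNReal.rpow_le_one ((setLIntegral_le_lintegral _ _).trans hf1) ?_
            have := hpq.pos
            positivity
          · rw [← setLIntegral_powKernel_compl_ball _ hρ0, hUc,
              ← setLIntegral_sub_left (powKernel (2 * n)) x _ measurableSet_ball.compl]
            refine lintegral_mono fun y => ?_
            simp only [powKernel]
            rw [ENNReal.ofReal_rpow_of_nonneg (by positivity) hq0.le,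
              ← Real.rpow_mul (norm_nonneg _)]
            refine le_of_eq ?_
            congr 2
            rw [hq]
            field_simp
      _ = B ^ (1 / q) * ENNReal.ofReal (t ^ (b - 1)) := by
          rw [one_mul, ENNReal.mul_rpow_of_nonneg _ _ (by positivity), mul_comm,
            ENNReal.ofReal_rpow_of_nonneg (by positivity) (by positivity), hρ,
            ← Real.rpow_mul ht.le, ← Real.rpow_mul ht.le]
          congr 3
          rw [hb, hq]
          field_simp
          ring

/-- The Hardy–Littlewood–Sobolev inequality as a bilinear estimate: on `{f y ≤ g x}` integrate
first in `y`, on the complement first in `x`. -/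
lemma exists_lintegral_mul_rieszPot_le [NeZero n] {s : ℝ} (hs : 0 < s) (hn : 2 * s < n) :
    ∃ C : ℝ≥0∞, C ≠ ⊤ ∧ ∀ f g : Rn n → ℝ≥0∞, Measurable f → Measurable g →
      ∫⁻ y, f y ^ bExp n s ≤ 1 → ∫⁻ y, g y ^ bExp n s ≤ 1 →
        ∫⁻ x, g x * rieszPot s f x ≤ C := by
  obtain ⟨C, hC, hmain⟩ := exists_setLIntegral_le_rpow (n := n) hs hn
  refine ⟨2 * C, by finiteness, ?_⟩
  have hb1 : 1 < bExp n s := (holderConjugate_bExp_qExp hs hn).lt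
  set b := bExp n s
  set a := (n : ℝ) - 2 * s with ha
  -- the contribution of the pairs on which the first function is the smaller one
  have half : ∀ f g : Rn n → ℝ≥0∞, Measurable f → Measurable g →
      ∫⁻ y, f y ^ b ≤ 1 → ∫⁻ y, g y ^ b ≤ 1 →
      ∫⁻ x, ∫⁻ y in {y | f y ≤ g x}, g x * (f y * powKernel a (x - y)) ≤ C := by
    intro f g hf hg hf1 hg1
    have hgt : ∀ᵐ x, g x < ⊤ := by
      have h := ae_lt_top (hg.pow_const b) (ne_top_of_le_ne_top ENNReal.one_ne_top hg1)
      filter_upwards [h] with x hx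
      by_contra hcon
      rw [not_lt_top_iff] at hcon
      rw [hcon, ENNReal.top_rpow_of_pos (by linarith)] at hx
      exact lt_irrefl _ hx
    calc ∫⁻ x, ∫⁻ y in {y | f y ≤ g x}, g x * (f y * powKernel a (x - y))
        ≤ ∫⁻ x, C * g x ^ b := by
          refine lintegral_mono_ae ?_
          filter_upwards [hgt] with x hx
          rw [lintegral_const_mul _ (by fun_prop)]
          rcases eq_or_ne (g x) 0 with h0 | h0
          · simp [h0]
          have ht : 0 < (g x).toReal := ENNReal.toReal_pos h0 hx.ne
          have := hmain f hf hf1 _ ht x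
          rw [ENNReal.ofReal_toReal hx.ne, ← ENNReal.ofReal_rpow_of_pos ht,
            ENNReal.ofReal_toReal hx.ne] at this
          calc _ ≤ g x * (C * g x ^ (b - 1)) := by gcongr
            _ = C * g x ^ b := by
              rw [mul_left_comm]
              congr 1
              nth_rw 1 [← ENNReal.rpow_one (g x)]
              rw [← ENNReal.rpow_add _ _ h0 hx.ne]
              congr 1
              ring
      _ ≤ C * 1 := by
          rw [lintegral_const_mul _ (hg.pow_const b)]
          gcongr
      _ = C := mul_one C
  intro f g hf hg hf1 hg1
  set F : Rn n × Rn n → ℝ≥0∞ := fun p => g p.1 * (f p.2 * powKernel a (p.1 - p.2)) with hF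
  have hFm : Measurable F := by fun_prop
  set S : Set (Rn n × Rn n) := {p | f p.2 ≤ g p.1}
  have hS : MeasurableSet S := measurableSet_le (by fun_prop) (by fun_prop)
  have e1 : ∫⁻ x, g x * rieszPot s f x = ∫⁻ p, F p ∂(volume.prod volume) := by
    rw [lintegral_prod _ hFm.aemeasurable]
    refine lintegral_congr fun x => ?_
    rw [rieszPot, ← lintegral_const_mul _ (by fun_prop)]
  rw [e1, ← lintegral_add_compl F hS, two_mul]
  refine add_le_add ?_ ?_
  · rw [← lintegral_indicator hS, lintegral_prod _ (hFm.indicator hS).aemeasurable]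
    refine le_trans (lintegral_mono fun x => ?_) (half f g hf hg hf1 hg1)
    rw [← lintegral_indicator (measurableSet_le hf measurable_const)]
    rfl
  · rw [← lintegral_indicator hS.compl,
      lintegral_prod_symm _ (hFm.indicator hS.compl).aemeasurable]
    refine le_trans (lintegral_mono fun y => ?_) (half g f hg hf hg1 hf1)
    rw [← lintegral_indicator (measurableSet_le hg measurable_const)]
    refine lintegral_mono fun x => ?_
    by_cases h : g x ≤ f y
    · rw [Set.indicator_of_mem (s := {y_1 | g y_1 ≤ f y}) h]
      refine (Set.indicator_le_self _ _ _).trans (le_of_eq ?_)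
      simp only [hF]
      rw [powKernel_sub_comm a x y]
      ring
    · rw [Set.indicator_of_notMem]
      · exact zero_le
      · simp only [S, Set.mem_compl_iff, Set.mem_ofPred_eq, not_not]
        exact (not_le.1 h).le

/-- The Hardy–Littlewood–Sobolev inequality, by duality from the bilinear estimate. -/
lemma exists_lintegral_rieszPot_rpow_le [NeZero n] {s : ℝ} (hs : 0 < s) (hn : 2 * s < n) :
    ∃ C : ℝ, 0 < C ∧ ∀ f : Rn n → ℝ≥0∞, Measurable f →
      (∫⁻ x, rieszPot s f x ^ qExp n s) ^ (1 / qExp n s)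
        ≤ ENNReal.ofReal C * (∫⁻ y, f y ^ bExp n s) ^ (1 / bExp n s) := by
  obtain ⟨C₀, hC₀, hmain⟩ := exists_lintegral_mul_rieszPot_le (n := n) hs hn
  have hpq := holderConjugate_bExp_qExp hs hn
  set b := bExp n s
  set q := qExp n s
  have hb0 : 0 < b := hpq.pos
  have hq0 : 0 < q := hpq.symm.pos
  have hq1 : 1 < q := hpq.symm.lt
  have hC : C₀ ≤ ENNReal.ofReal (C₀.toReal + 1) := by
    rw [← ENNReal.ofReal_toReal hC₀]
    exact ENNReal.ofReal_le_ofReal (by simp)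
  refine ⟨C₀.toReal + 1, by positivity, ?_⟩
  set C := ENNReal.ofReal (C₀.toReal + 1) with hCdef
  have hCpos : C ≠ 0 := by rw [hCdef]; simp; positivity
  -- scaling in both arguments
  have bil : ∀ f g : Rn n → ℝ≥0∞, Measurable f → Measurable g →
      ∫⁻ y, f y ^ b ≠ 0 → ∫⁻ y, f y ^ b ≠ ⊤ → ∫⁻ y, g y ^ b ≠ 0 → ∫⁻ y, g y ^ b ≠ ⊤ →
      ∫⁻ x, g x * rieszPot s f x ≤ C * (∫⁻ y, f y ^ b) ^ (1 / b) * (∫⁻ y, g y ^ b) ^ (1 / b) := by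
    intro f g hf hg hf0 hft hg0 hgt
    set α := (∫⁻ y, f y ^ b) ^ (1 / b) with hα
    set γ := (∫⁻ y, g y ^ b) ^ (1 / b) with hγ
    have hα0 : α ≠ 0 := by rw [hα]; simp [hf0, hft, hb0]
    have hαt : α ≠ ⊤ := ENNReal.rpow_ne_top_of_nonneg (by positivity) hft
    have hγ0 : γ ≠ 0 := by rw [hγ]; simp [hg0, hgt, hb0]
    have hγt : γ ≠ ⊤ := ENNReal.rpow_ne_top_of_nonneg (by positivity) hgt
    have norm1 : ∀ (h : Rn n → ℝ≥0∞) (η : ℝ≥0∞), Measurable h → η = (∫⁻ y, h y ^ b) ^ (1 / b) →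
        η ≠ 0 → η ≠ ⊤ → ∫⁻ y, (η⁻¹ * h y) ^ b ≤ 1 := by
      intro h η hh hη hη0 hηt
      have e : ∫⁻ y, h y ^ b = η ^ b := by
        rw [hη, ← ENNReal.rpow_mul, one_div_mul_cancel hb0.ne', ENNReal.rpow_one]
      simp_rw [ENNReal.mul_rpow_of_nonneg _ _ hb0.le]
      rw [lintegral_const_mul _ (hh.pow_const b), e, ENNReal.inv_rpow, ENNReal.inv_mul_cancel]
      · simp [hη0, hηt, hb0]
      · simp [hη0, hηt]
    have := hmain (fun y => α⁻¹ * f y) (fun y => γ⁻¹ * g y) (by fun_prop) (by fun_prop)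
      (norm1 f α hf hα hα0 hαt) (norm1 g γ hg hγ hγ0 hγt)
    have e : ∀ x, γ⁻¹ * g x * rieszPot s (fun y => α⁻¹ * f y) x
        = (γ⁻¹ * α⁻¹) * (g x * rieszPot s f x) := by
      intro x
      simp only [rieszPot, mul_assoc]
      rw [lintegral_const_mul _ (by fun_prop)]
      ring
    simp_rw [e] at this
    have hgF : Measurable fun x => g x * rieszPot s f x := hg.mul (measurable_rieszPot hf)
    rw [lintegral_const_mul _ hgF] at this
    calc ∫⁻ x, g x * rieszPot s f x
        = α * γ * (γ⁻¹ * α⁻¹ * ∫⁻ x, g x * rieszPot s f x) := by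
          rw [← mul_assoc, show α * γ * (γ⁻¹ * α⁻¹) = (α * α⁻¹) * (γ * γ⁻¹) by ring,
            ENNReal.mul_inv_cancel hα0 hαt, ENNReal.mul_inv_cancel hγ0 hγt, one_mul, one_mul]
      _ ≤ α * γ * C := by gcongr; exact this.trans hC
      _ = C * α * γ := by ring
  intro f hf
  rcases eq_or_ne (∫⁻ y, f y ^ b) 0 with hf0 | hf0
  · rw [lintegral_eq_zero_iff (hf.pow_const b)] at hf0
    have hz : ∀ x, rieszPot s f x = 0 := by
      intro x
      rw [rieszPot, lintegral_eq_zero_iff (by fun_prop)]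
      filter_upwards [hf0] with y hy
      have : f y = 0 := by simpa [hb0, hb0.not_gt] using hy
      simp [this]
    simp [hz, hq0]
  rcases eq_or_ne (∫⁻ y, f y ^ b) ⊤ with hft | hft
  · rw [hft, ENNReal.top_rpow_of_pos (by positivity), ENNReal.mul_top hCpos]
    exact le_top
  -- test against the truncations of `(Jf) ^ (q - 1)`
  set F := rieszPot s f with hFdef
  have hF : Measurable F := measurable_rieszPot hf
  set α := (∫⁻ y, f y ^ b) ^ (1 / b) with hα
  set T : ℕ → Rn n → ℝ≥0∞ := fun k =>
    (Metric.ball (0 : Rn n) k).indicator fun x => min (F x) k with hT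
  have hTm : ∀ k, Measurable (T k) := fun k =>
    (hF.min measurable_const).indicator measurableSet_ball
  have hTF : ∀ k x, T k x ≤ F x := fun k x =>
    (Set.indicator_le_self _ _ _).trans (min_le_left _ _)
  have hTfin : ∀ k, ∫⁻ x, T k x ^ q ≠ ⊤ := by
    intro k
    have hle : ∫⁻ x, T k x ^ q ≤ ∫⁻ x in Metric.ball (0 : Rn n) k, (k : ℝ≥0∞) ^ q := by
      rw [← lintegral_indicator measurableSet_ball]
      refine lintegral_mono fun x => ?_
      by_cases hx : x ∈ Metric.ball (0 : Rn n) k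
      · simp only [hT, Set.indicator_of_mem hx]
        gcongr
        exact min_le_right _ _
      · simp only [hT, Set.indicator_of_notMem hx]
        simp [hq0]
    refine ne_top_of_le_ne_top ?_ hle
    rw [setLIntegral_const]
    have := (measure_ball_lt_top (μ := (volume : Measure (Rn n))) (x := 0) (r := k)).ne
    finiteness
  have hTle : ∀ k, (∫⁻ x, T k x ^ q) ^ (1 / q) ≤ C * α := by
    intro k
    rcases eq_or_ne (∫⁻ x, T k x ^ q) 0 with h0 | h0
    · simp [h0, hq0]
    have e : ∀ x, (T k x ^ (q - 1)) ^ b = T k x ^ q := by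
      intro x
      rw [← ENNReal.rpow_mul, hpq.symm.sub_one_mul_conj]
    have h := bil f (fun x => T k x ^ (q - 1)) hf ((hTm k).pow_const _) hf0 hft
      (by simp_rw [e]; exact h0) (by simp_rw [e]; exact hTfin k)
    simp_rw [e] at h
    have h' : ∫⁻ x, T k x ^ q ≤ ∫⁻ x, T k x ^ (q - 1) * F x := by
      refine lintegral_mono fun x => ?_
      calc T k x ^ q = T k x ^ (q - 1) * T k x := by
            nth_rw 3 [← ENNReal.rpow_one (T k x)]
            rw [← ENNReal.rpow_add_of_nonneg _ _ (by linarith) zero_le_one]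
            congr 1
            ring
        _ ≤ _ := by gcongr; exact hTF k x
    set I := ∫⁻ x, T k x ^ q
    have h2 : I ≤ C * α * I ^ (1 / b) := h'.trans h
    have hI0 : I ^ (1 / b) ≠ 0 := by simp [h0, hb0.le]
    have hIt : I ^ (1 / b) ≠ ⊤ := ENNReal.rpow_ne_top_of_nonneg (by positivity) (hTfin k)
    have h3 : I ^ (1 / q) * I ^ (1 / b) = I := by
      rw [← ENNReal.rpow_add _ _ h0 (hTfin k), one_div, one_div, hpq.symm.inv_add_inv_eq_one,
        ENNReal.rpow_one]
    rw [← ENNReal.mul_le_mul_iff_left hI0 hIt, h3]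
    exact h2
  have hlim : ∫⁻ x, F x ^ q = ⨆ k, ∫⁻ x, T k x ^ q := by
    have hmono : Monotone T := by
      intro k l hkl x
      refine (Set.indicator_le_indicator_of_subset (Metric.ball_subset_ball (by exact_mod_cast hkl))
        (fun _ => zero_le) x).trans (Set.indicator_le_indicator ?_)
      exact min_le_min_left _ (by exact_mod_cast hkl)
    rw [← lintegral_iSup (fun k => (hTm k).pow_const q)
      fun k l hkl x => ENNReal.rpow_le_rpow (hmono hkl x) hq0.le]
    refine lintegral_congr fun x => ?_
    have hsup : F x = ⨆ k, T k x := by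
      refine le_antisymm ?_ (iSup_le fun k => hTF k x)
      obtain ⟨N, hN⟩ := exists_nat_gt ‖x‖
      refine le_of_forall_lt fun c hc => ?_
      obtain ⟨m, hm⟩ := ENNReal.exists_nat_gt (hc.trans_le le_top).ne
      refine lt_of_lt_of_le ?_ (le_iSup _ (max N m))
      have hx : x ∈ Metric.ball (0 : Rn n) (max N m : ℕ) := by
        simp only [mem_ball_zero_iff]
        exact hN.trans_le (by exact_mod_cast le_max_left _ _)
      simp only [hT, Set.indicator_of_mem hx]
      exact lt_min hc (hm.trans_le (by exact_mod_cast le_max_right _ _))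
    rw [hsup]
    exact (ENNReal.orderIsoRpow q hq0).map_iSup _
  have hq' : (∫⁻ x, F x ^ q) ≤ (C * α) ^ q := by
    rw [hlim]
    refine iSup_le fun k => ?_
    have := ENNReal.rpow_le_rpow (hTle k) hq0.le
    rwa [← ENNReal.rpow_mul, one_div_mul_cancel hq0.ne', ENNReal.rpow_one] at this
  calc (∫⁻ x, F x ^ q) ^ (1 / q) ≤ ((C * α) ^ q) ^ (1 / q) := by gcongr
    _ = C * α := by rw [← ENNReal.rpow_mul, mul_one_div_cancel hq0.ne', ENNReal.rpow_one]

/-! ### The Riesz potential of an `L^β` function -/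

lemma enorm_rieszIntegrand (s : ℝ) (ψ : Rn n → ℝ) (x y : Rn n) :
    ‖rieszIntegrand s ψ x y‖ₑ = ‖ψ y‖ₑ * powKernel ((n : ℝ) - 2 * s) (x - y) := by
  rw [rieszIntegrand, div_eq_mul_inv, enorm_mul, powKernel, Real.rpow_neg (norm_nonneg _),
    Real.enorm_of_nonneg (by positivity : 0 ≤ (‖x - y‖ ^ ((n : ℝ) - 2 * s))⁻¹)]

lemma lintegral_enorm_rieszIntegrand (s : ℝ) (ψ : Rn n → ℝ) (x : Rn n) :
    ∫⁻ y, ‖rieszIntegrand s ψ x y‖ₑ = rieszPot s (fun y => ‖ψ y‖ₑ) x :=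
  lintegral_congr fun y => enorm_rieszIntegrand s ψ x y

lemma rieszPot_congr {s : ℝ} {f g : Rn n → ℝ≥0∞} (h : f =ᵐ[volume] g) :
    rieszPot s f = rieszPot s g := by
  ext x
  refine lintegral_congr_ae ?_
  filter_upwards [h] with y hy
  rw [hy]

lemma rieszJ_congr {s : ℝ} {f g : Rn n → ℝ} (h : f =ᵐ[volume] g) :
    rieszJ s f = rieszJ s g := by
  ext x
  refine integral_congr_ae ?_
  filter_upwards [h] with y hy
  rw [rieszIntegrand, rieszIntegrand, hy]

lemma aestronglyMeasurable_rieszIntegrand {s : ℝ} {ψ : Rn n → ℝ}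
    (hψ : AEStronglyMeasurable ψ volume) (x : Rn n) :
    AEStronglyMeasurable (rieszIntegrand s ψ x) volume :=
  hψ.mul (by fun_prop : Measurable fun y : Rn n =>
    (‖x - y‖ ^ ((n : ℝ) - 2 * s))⁻¹).aestronglyMeasurable

lemma integrable_rieszIntegrand {s : ℝ} {ψ : Rn n → ℝ} (hψ : AEStronglyMeasurable ψ volume)
    {x : Rn n} (hx : rieszPot s (fun y => ‖ψ y‖ₑ) x < ⊤) :
    Integrable (rieszIntegrand s ψ x) volume := by
  refine ⟨aestronglyMeasurable_rieszIntegrand hψ x, ?_⟩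
  rwa [hasFiniteIntegral_iff_enorm, lintegral_enorm_rieszIntegrand]

lemma enorm_rieszJ_le (s : ℝ) (ψ : Rn n → ℝ) (x : Rn n) :
    ‖rieszJ s ψ x‖ₑ ≤ rieszPot s (fun y => ‖ψ y‖ₑ) x := by
  rw [← lintegral_enorm_rieszIntegrand]
  exact enorm_integral_le_lintegral_enorm _

lemma measurable_rieszJ_of_measurable {s : ℝ} {ψ : Rn n → ℝ} (hψ : Measurable ψ) :
    Measurable (rieszJ s ψ) := by
  have h : StronglyMeasurable fun p : Rn n × Rn n => rieszIntegrand s ψ p.1 p.2 := by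
    refine Measurable.stronglyMeasurable ?_
    unfold rieszIntegrand
    fun_prop
  exact h.integral_prod_right'.measurable

lemma measurable_rieszJ {s : ℝ} {ψ : Rn n → ℝ} (hψ : AEStronglyMeasurable ψ volume) :
    Measurable (rieszJ s ψ) := by
  rw [rieszJ_congr hψ.aemeasurable.ae_eq_mk]
  exact measurable_rieszJ_of_measurable hψ.aemeasurable.measurable_mk

lemma rieszJ_sub {s : ℝ} {ψ χ : Rn n → ℝ} {x : Rn n} (hψ : Integrable (rieszIntegrand s ψ x))
    (hχ : Integrable (rieszIntegrand s χ x)) :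
    rieszJ s (fun y => ψ y - χ y) x = rieszJ s ψ x - rieszJ s χ x := by
  rw [rieszJ, rieszJ, rieszJ, ← integral_sub hψ hχ]
  refine integral_congr_ae (.of_forall fun y => ?_)
  simp [rieszIntegrand, sub_div]

lemma eLpNorm_ofReal_eq {r : ℝ} (hr : 0 < r) (ψ : Rn n → ℝ) (μ : Measure (Rn n)) :
    eLpNorm ψ (ENNReal.ofReal r) μ = (∫⁻ x, ‖ψ x‖ₑ ^ r ∂μ) ^ (1 / r) := by
  rw [eLpNorm_eq_lintegral_rpow_enorm_toReal (by simpa using hr) ENNReal.ofReal_ne_top,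
    ENNReal.toReal_ofReal hr.le]

lemma bExp_pos {s : ℝ} (hs : 0 < s) (hn : 2 * s < n) : 0 < bExp n s :=
  (holderConjugate_bExp_qExp hs hn).pos

lemma qExp_pos {s : ℝ} (hs : 0 < s) (hn : 2 * s < n) : 0 < qExp n s :=
  (holderConjugate_bExp_qExp hs hn).symm.pos

lemma one_le_betaExp {s : ℝ} (hs : 0 < s) (hn : 2 * s < n) : 1 ≤ betaExp n s := by
  have := (holderConjugate_bExp_qExp hs hn).lt
  rw [← ENNReal.ofReal_one]
  exact ENNReal.ofReal_le_ofReal this.le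

lemma one_le_critExp {s : ℝ} (hs : 0 < s) (hn : 2 * s < n) : 1 ≤ critExp n s := by
  have := (holderConjugate_bExp_qExp hs hn).symm.lt
  rw [← ENNReal.ofReal_one]
  exact ENNReal.ofReal_le_ofReal this.le

lemma exists_eLpNorm_rieszPot_le [NeZero n] {s : ℝ} (hs : 0 < s) (hn : 2 * s < n) :
    ∃ C : ℝ, 0 < C ∧ ∀ ψ : Rn n → ℝ, AEStronglyMeasurable ψ volume →
      (∫⁻ x, rieszPot s (fun y => ‖ψ y‖ₑ) x ^ qExp n s) ^ (1 / qExp n s)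
        ≤ ENNReal.ofReal C * eLpNorm ψ (betaExp n s) volume := by
  obtain ⟨C, hC, h⟩ := exists_lintegral_rieszPot_rpow_le (n := n) hs hn
  refine ⟨C, hC, fun ψ hψ => ?_⟩
  have e : (fun y => ‖ψ y‖ₑ) =ᵐ[volume] fun y => ‖hψ.aemeasurable.mk ψ y‖ₑ := by
    filter_upwards [hψ.aemeasurable.ae_eq_mk] with y hy
    rw [hy]
  rw [betaExp, ← bExp, eLpNorm_ofReal_eq (bExp_pos hs hn), rieszPot_congr e]
  refine (h _ hψ.aemeasurable.measurable_mk.enorm).trans (le_of_eq ?_)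
  congr 2
  refine lintegral_congr_ae ?_
  filter_upwards [e] with y hy
  rw [hy]

lemma ae_integrable_rieszIntegrand [NeZero n] {s : ℝ} (hs : 0 < s) (hn : 2 * s < n)
    {ψ : Rn n → ℝ} (hψ : MemLp ψ (betaExp n s) volume) :
    ∀ᵐ x, Integrable (rieszIntegrand s ψ x) volume := by
  obtain ⟨C, hC, h⟩ := exists_eLpNorm_rieszPot_le (n := n) hs hn
  have hq := qExp_pos hs hn
  have h1 : (∫⁻ x, rieszPot s (fun y => ‖ψ y‖ₑ) x ^ qExp n s) ^ (1 / qExp n s) < ⊤ :=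
    (h ψ hψ.1).trans_lt (ENNReal.mul_lt_top ENNReal.ofReal_lt_top hψ.2)
  rw [ENNReal.rpow_lt_top_iff_of_pos (by positivity)] at h1
  have e : (fun y => ‖ψ y‖ₑ) =ᵐ[volume] fun y => ‖hψ.1.aemeasurable.mk ψ y‖ₑ := by
    filter_upwards [hψ.1.aemeasurable.ae_eq_mk] with y hy
    rw [hy]
  have hm : Measurable (rieszPot s (fun y => ‖ψ y‖ₑ)) := by
    rw [rieszPot_congr e]
    exact measurable_rieszPot hψ.1.aemeasurable.measurable_mk.enorm
  filter_upwards [ae_lt_top (hm.pow_const _) h1.ne] with x hx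
  exact integrable_rieszIntegrand hψ.1 ((ENNReal.rpow_lt_top_iff_of_pos hq).1 hx)

/-- `J` maps `L^β` boundedly to `L^{2*}`. -/
lemma exists_eLpNorm_rieszJ_le [NeZero n] {s : ℝ} (hs : 0 < s) (hn : 2 * s < n) :
    ∃ C : ℝ, 0 < C ∧ ∀ ψ : Rn n → ℝ, MemLp ψ (betaExp n s) volume →
      MemLp (rieszJ s ψ) (critExp n s) volume ∧ eLpNorm (rieszJ s ψ) (critExp n s) volume
        ≤ ENNReal.ofReal C * eLpNorm ψ (betaExp n s) volume := by
  obtain ⟨C, hC, h⟩ := exists_eLpNorm_rieszPot_le (n := n) hs hn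
  refine ⟨C, hC, fun ψ hψ => ?_⟩
  have hle : eLpNorm (rieszJ s ψ) (critExp n s) volume
      ≤ ENNReal.ofReal C * eLpNorm ψ (betaExp n s) volume := by
    have hq := qExp_pos hs hn
    rw [critExp, ← qExp, eLpNorm_ofReal_eq hq]
    refine le_trans ?_ (h ψ hψ.1)
    gcongr with x
    exact enorm_rieszJ_le s ψ x
  exact ⟨⟨(measurable_rieszJ hψ.1).aestronglyMeasurable,
    hle.trans_lt (ENNReal.mul_lt_top ENNReal.ofReal_lt_top hψ.2)⟩, hle⟩

/-! ### The bound in `L^∞` -/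

lemma setLIntegral_mul_powKernel_le {a r r' : ℝ} (hr : r.HolderConjugate r') {ψ : Rn n → ℝ}
    (hψ : AEStronglyMeasurable ψ volume) (x : Rn n) {S : Set (Rn n)} (hS : MeasurableSet S) :
    ∫⁻ y in {y | x - y ∈ S}, ‖ψ y‖ₑ * powKernel a (x - y)
      ≤ eLpNorm ψ (ENNReal.ofReal r) (volume.restrict {y | x - y ∈ S})
        * (∫⁻ z in S, powKernel (a * r') z) ^ (1 / r') := by
  refine (ENNReal.lintegral_mul_le_Lp_mul_Lq _ hr hψ.restrict.aemeasurable.enorm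
    (by fun_prop)).trans (le_of_eq ?_)
  rw [eLpNorm_ofReal_eq hr.pos, ← setLIntegral_sub_left (powKernel (a * r')) x S hS]
  congr 2
  refine lintegral_congr fun y => ?_
  simp only [powKernel]
  rw [ENNReal.ofReal_rpow_of_nonneg (by positivity) hr.symm.nonneg, ← Real.rpow_mul (norm_nonneg _),
    neg_mul]

/-- Near `x` the kernel is in the space dual to `L^r`, because `r > n / 2s`; far from `x` it is in
the space dual to `L^β`. -/
lemma exists_rieszPot_le_unifLocNorm [NeZero n] {s r : ℝ} (hs : 0 < s) (hn : 2 * s < n)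
    (hr : (n : ℝ) / (2 * s) < r) :
    ∃ C : ℝ, 0 < C ∧ ∀ ψ : Rn n → ℝ, AEStronglyMeasurable ψ volume → ∀ x,
      rieszPot s (fun y => ‖ψ y‖ₑ) x ≤ ENNReal.ofReal C *
        (unifLocNorm (ENNReal.ofReal r) ψ + eLpNorm ψ (betaExp n s) volume) := by
  have hpq := holderConjugate_bExp_qExp hs hn
  have h1 : 0 < (n : ℝ) - 2 * s := by linarith
  have h3 : 0 < (n : ℝ) := by linarith
  have hr1 : 1 < r := lt_trans (by rw [one_lt_div (by positivity)]; linarith) hr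
  have hrr := Real.HolderConjugate.conjExponent hr1
  set r' := r.conjExponent with hr'
  have hr'0 : 0 < r' := hrr.symm.pos
  have ha : ((n : ℝ) - 2 * s) * r' < n := by
    rw [hr', Real.conjExponent, mul_div_assoc', div_lt_iff₀ (by linarith)]
    rw [div_lt_iff₀ (by positivity)] at hr
    linarith
  set A := (∫⁻ z in Metric.ball (0 : Rn n) 1, powKernel (((n : ℝ) - 2 * s) * r') z) ^ (1 / r')
  set B := (∫⁻ z in (Metric.ball (0 : Rn n) 1)ᶜ,
    powKernel (((n : ℝ) - 2 * s) * qExp n s) z) ^ (1 / qExp n s)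
  have hA : A ≠ ⊤ := ENNReal.rpow_ne_top_of_nonneg (by positivity)
    (setLIntegral_powKernel_ball_lt_top ha 1).ne
  have hB : B ≠ ⊤ := by
    refine ENNReal.rpow_ne_top_of_nonneg ?_ (setLIntegral_powKernel_compl_ball_lt_top ?_).ne
    · have := qExp_pos hs hn
      positivity
    · rw [qExp, mul_div_cancel₀ _ h1.ne']
      linarith
  have hAB : A + B ≤ ENNReal.ofReal ((A + B).toReal + 1) := by
    rw [← ENNReal.ofReal_toReal (a := A + B) (by finiteness)]
    exact ENNReal.ofReal_le_ofReal (by simp)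
  refine ⟨(A + B).toReal + 1, by positivity, fun ψ hψ x => ?_⟩
  suffices hmain : rieszPot s (fun y => ‖ψ y‖ₑ) x
      ≤ (A + B) * (unifLocNorm (ENNReal.ofReal r) ψ + eLpNorm ψ (betaExp n s) volume) from
    hmain.trans (by gcongr)
  set U : Set (Rn n) := {y | x - y ∈ Metric.ball (0 : Rn n) 1} with hU
  have hUm : MeasurableSet U := (measurable_const.sub measurable_id) measurableSet_ball
  have hUx : U = Metric.ball x 1 := by
    ext y
    simp [hU, dist_eq_norm, norm_sub_rev]
  rw [rieszPot, ← lintegral_add_compl _ hUm]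
  have near := setLIntegral_mul_powKernel_le (a := (n : ℝ) - 2 * s) hrr hψ x
    (measurableSet_ball (x := (0 : Rn n)) (ε := 1))
  have far := setLIntegral_mul_powKernel_le (a := (n : ℝ) - 2 * s) hpq hψ x
    (measurableSet_ball (x := (0 : Rn n)) (ε := 1)).compl
  refine (add_le_add near far).trans ?_
  calc _ ≤ eLpNorm ψ (ENNReal.ofReal r) (volume.restrict U) * A
        + eLpNorm ψ (ENNReal.ofReal (bExp n s)) (volume.restrict Uᶜ) * B := le_rfl
    _ ≤ (unifLocNorm (ENNReal.ofReal r) ψ + eLpNorm ψ (betaExp n s) volume) * A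
        + (unifLocNorm (ENNReal.ofReal r) ψ + eLpNorm ψ (betaExp n s) volume) * B := by
        refine add_le_add (mul_le_mul_left ?_ A) (mul_le_mul_left ?_ B)
        · refine le_trans ?_ le_self_add
          rw [hUx]
          exact le_iSup (fun z => eLpNorm ψ (ENNReal.ofReal r) (volume.restrict (Metric.ball z 1)))
            x
        · exact le_trans (eLpNorm_mono_measure _ Measure.restrict_le_self) le_add_self
    _ = _ := by ring

lemma eLpNorm_rieszJ_top_le {s : ℝ} {ψ : Rn n → ℝ} (hψ : AEStronglyMeasurable ψ volume)
    {K : ℝ≥0∞} (h : ∀ x, rieszPot s (fun y => ‖ψ y‖ₑ) x ≤ K) (hK : K < ⊤) :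
    MemLp (rieszJ s ψ) ⊤ volume ∧ eLpNorm (rieszJ s ψ) ⊤ volume ≤ K := by
  have hle : eLpNorm (rieszJ s ψ) ⊤ volume ≤ K := by
    rw [eLpNorm_exponent_top]
    exact essSup_le_of_ae_le _ (.of_forall fun x => (enorm_rieszJ_le s ψ x).trans (h x))
  exact ⟨⟨(measurable_rieszJ hψ).aestronglyMeasurable, hle.trans_lt hK⟩, hle⟩

lemma unifLocNorm_le_eLpNorm_top {r : ℝ} (hr : 0 < r) {ψ : Rn n → ℝ}
    (hψ : AEStronglyMeasurable ψ volume) :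
    unifLocNorm (ENNReal.ofReal r) ψ
      ≤ eLpNorm ψ ⊤ volume * volume (Metric.ball (0 : Rn n) 1) ^ (1 / r) := by
  refine iSup_le fun z => ?_
  refine (eLpNorm_le_eLpNorm_mul_rpow_measure_univ le_top hψ.restrict).trans ?_
  simp only [Measure.restrict_apply_univ, ENNReal.toReal_top, div_zero, sub_zero,
    ENNReal.toReal_ofReal hr.le]
  rw [Measure.addHaar_ball_center]
  exact mul_le_mul_left (eLpNorm_mono_measure ψ Measure.restrict_le_self) _

/-! ### Subordination: power kernels as superpositions -/

/-- Fubini for a kernel `κ` written as a superposition `κ x = ∫ k t x dμ(t)` of nonnegative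
kernels. -/
lemma integral_superposition_mul {T X : Type*} [MeasurableSpace T] [MeasurableSpace X]
    {μ : Measure T} {ν : Measure X} [SFinite μ] [SFinite ν] {k : T → X → ℝ} {κ : X → ℝ} {F : X → ℂ}
    (hk : Measurable (Function.uncurry k)) (hk0 : ∀ᵐ t ∂μ, ∀ x, 0 ≤ k t x)
    (hκ : ∀ᵐ x ∂ν, Integrable (fun t => k t x) μ ∧ ∫ t, k t x ∂μ = κ x)
    (hF : AEStronglyMeasurable F ν) (hκF : Integrable (fun x => (κ x : ℂ) * F x) ν) :
    ∫ x, (κ x : ℂ) * F x ∂ν = ∫ t, ∫ x, (k t x : ℂ) * F x ∂ν ∂μ := by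
  have hm : AEStronglyMeasurable (fun p : X × T => (k p.2 p.1 : ℂ) * F p.1) (ν.prod μ) := by
    refine AEStronglyMeasurable.mul ?_ hF.comp_fst
    exact (Complex.measurable_ofReal.comp (hk.comp measurable_swap)).aestronglyMeasurable
  have hint : Integrable (fun p : X × T => (k p.2 p.1 : ℂ) * F p.1) (ν.prod μ) := by
    rw [integrable_prod_iff hm]
    refine ⟨?_, ?_⟩
    · filter_upwards [hκ] with x hx
      exact hx.1.ofReal.mul_const _
    · refine hκF.norm.congr ?_
      filter_upwards [hκ] with x hx
      have e : ∀ᵐ t ∂μ, ‖(k t x : ℂ) * F x‖ = k t x * ‖F x‖ := by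
        filter_upwards [hk0] with t ht
        rw [norm_mul, Complex.norm_real, Real.norm_of_nonneg (ht x)]
      have h0 : 0 ≤ κ x := by
        rw [← hx.2]
        refine integral_nonneg_of_ae ?_
        filter_upwards [hk0] with t ht using ht x
      rw [integral_congr_ae e, integral_mul_const, hx.2, norm_mul, Complex.norm_real,
        Real.norm_of_nonneg h0]
  rw [← integral_integral_swap (f := fun x t => (k t x : ℂ) * F x) hint]
  refine integral_congr_ae ?_
  filter_upwards [hκ] with x hx
  rw [integral_mul_const, integral_complex_ofReal, hx.2]

lemma integrableOn_rpow_mul_exp_neg_mul {a r : ℝ} (ha : 0 < a) (hr : 0 < r) :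
    IntegrableOn (fun t : ℝ => t ^ (a - 1) * Real.exp (-(r * t))) (Set.Ioi 0) := by
  have h : ∫ t in Set.Ioi (0 : ℝ), t ^ (a - 1) * Real.exp (-(r * t)) ≠ 0 := by
    rw [Real.integral_rpow_mul_exp_neg_mul_Ioi ha hr]
    have := Real.Gamma_pos_of_pos ha
    positivity
  exact not_imp_comm.1 integral_undef h

/-- The Gamma integral after the substitution `t ↦ 1 / t`. -/
lemma integral_rpow_mul_exp_neg_div {a r : ℝ} (ha : 0 < a) (hr : 0 < r) :
    IntegrableOn (fun t : ℝ => t ^ (-a - 1) * Real.exp (-(r / t))) (Set.Ioi 0) ∧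
    ∫ t in Set.Ioi (0 : ℝ), t ^ (-a - 1) * Real.exp (-(r / t)) = (1 / r) ^ a * Real.Gamma a := by
  have e : Set.EqOn (fun t : ℝ => (|(-1 : ℝ)| * t ^ ((-1 : ℝ) - 1)) •
      ((t ^ (-1 : ℝ)) ^ (a - 1) * Real.exp (-(r * t ^ (-1 : ℝ)))))
      (fun t : ℝ => t ^ (-a - 1) * Real.exp (-(r / t))) (Set.Ioi 0) := by
    intro t ht
    have ht : 0 < t := ht
    simp only [abs_neg, abs_one, one_mul, smul_eq_mul]
    rw [← Real.rpow_mul ht.le, ← mul_assoc, ← Real.rpow_add ht, Real.rpow_neg_one, div_eq_mul_inv]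
    congr 2
    ring
  refine ⟨?_, ?_⟩
  · refine IntegrableOn.congr_fun ?_ e measurableSet_Ioi
    exact (integrableOn_Ioi_comp_rpow_iff
      (fun u : ℝ => u ^ (a - 1) * Real.exp (-(r * u))) (by norm_num)).2
      (integrableOn_rpow_mul_exp_neg_mul ha hr)
  · rw [← setIntegral_congr_fun measurableSet_Ioi e,
      integral_comp_rpow_Ioi (fun u : ℝ => u ^ (a - 1) * Real.exp (-(r * u))) (by norm_num),
      Real.integral_rpow_mul_exp_neg_mul_Ioi ha hr]

/-- The character `w ↦ e ^ (2πi⟨w, ξ⟩)`. -/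
noncomputable def expChar (w ξ : Rn n) : ℂ :=
  Complex.exp (((2 * Real.pi * inner ℝ w ξ : ℝ) : ℂ) * Complex.I)

lemma norm_expChar (w ξ : Rn n) : ‖expChar w ξ‖ = 1 := Complex.norm_exp_ofReal_mul_I _

lemma continuous_expChar : Continuous fun p : Rn n × Rn n => expChar p.1 p.2 := by
  unfold expChar; fun_prop

lemma expChar_add (w v ξ : Rn n) : expChar (w + v) ξ = expChar w ξ * expChar v ξ := by
  simp only [expChar, inner_add_left, ← Complex.exp_add]
  congr 1
  push_cast
  ring

lemma expChar_add_expChar_neg (h ξ : Rn n) :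
    expChar h ξ + expChar (-h) ξ = ((2 * Real.cos (2 * Real.pi * inner ℝ h ξ) : ℝ) : ℂ) := by
  simp only [expChar, inner_neg_left]
  push_cast
  rw [Complex.two_cos]
  ring_nf

lemma integral_gaussian_mul_expChar {t : ℝ} (ht : 0 < t) (ξ : Rn n) :
    ∫ w : Rn n, (Real.exp (-(‖w‖ ^ 2 * t)) : ℂ) * expChar w ξ
      = ((Real.pi ^ ((n : ℝ) / 2) * (t ^ (-((n : ℝ) / 2))
          * Real.exp (-(Real.pi ^ 2 * ‖ξ‖ ^ 2 / t))) : ℝ) : ℂ) := by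
  have h := fourier_gaussian_innerProductSpace (V := Rn n) (b := (t : ℂ)) (by simpa using ht) (-ξ)
  rw [Real.fourier_eq'] at h
  have e : ∀ w : Rn n, (Real.exp (-(‖w‖ ^ 2 * t)) : ℂ) * expChar w ξ
      = Complex.exp (((-2 * Real.pi * inner ℝ w (-ξ) : ℝ) : ℂ) * Complex.I)
        • Complex.exp (-(t : ℂ) * (‖w‖ : ℂ) ^ 2) := by
    intro w
    rw [smul_eq_mul, mul_comm, expChar, inner_neg_right]
    push_cast
    congr 2
    · ring
    · ring
  simp_rw [e]
  rw [h]
  have h1 : ((Real.pi : ℂ) / t) ^ ((Module.finrank ℝ (Rn n) : ℂ) / 2)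
      = ((Real.pi ^ ((n : ℝ) / 2) * t ^ (-((n : ℝ) / 2)) : ℝ) : ℂ) := by
    rw [Real.rpow_neg ht.le, ← div_eq_mul_inv, ← Real.div_rpow Real.pi_pos.le ht.le,
      Complex.ofReal_cpow (by positivity), finrank_euclideanSpace, Fintype.card_fin]
    push_cast
    rfl
  rw [h1, ← mul_assoc, Complex.ofReal_mul]
  rw [norm_neg]
  push_cast
  ring_nf

lemma ae_ne_zero [NeZero n] : ∀ᵐ x : Rn n, x ≠ 0 := by
  rw [ae_iff]
  simp

/-- The value at the level of pairings of the formula "the Fourier transform of `|w| ^ (-a)` is a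
positive multiple of `|ξ| ^ (a - n)`", for `G` the inverse Fourier transform of `γ`. Both power
functions are superpositions of the same family of Gaussians. -/
lemma exists_integral_rpow_mul_eq [NeZero n] {s : ℝ} (hs : 0 < s) (hn : 2 * s < n) :
    ∃ c : ℝ, 0 < c ∧ ∀ γ G : Rn n → ℂ, Integrable γ → AEStronglyMeasurable G volume →
      (∀ w, G w = ∫ ξ, γ ξ * expChar w ξ) →
      Integrable (fun ξ => ((‖ξ‖ ^ (-(2 * s)) : ℝ) : ℂ) * γ ξ) →
      Integrable (fun w => ((‖w‖ ^ (-((n : ℝ) - 2 * s)) : ℝ) : ℂ) * G w) →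
      ∫ w, ((‖w‖ ^ (-((n : ℝ) - 2 * s)) : ℝ) : ℂ) * G w
        = c * ∫ ξ, ((‖ξ‖ ^ (-(2 * s)) : ℝ) : ℂ) * γ ξ := by
  set a := (n : ℝ) - 2 * s with ha
  have ha0 : 0 < a := by rw [ha]; linarith
  have hΓa := Real.Gamma_pos_of_pos (half_pos ha0)
  have hΓs := Real.Gamma_pos_of_pos hs
  set c₁ := Real.Gamma (a / 2) with hc₁
  set c₂ := Real.pi ^ ((n : ℝ) / 2) * ((1 / Real.pi ^ 2) ^ s * Real.Gamma s) with hc₂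
  have hc₂0 : 0 < c₂ := by have := Real.pi_pos; positivity
  refine ⟨c₂ / c₁, by positivity, fun γ G hγ hG hGγ hγi hGi => ?_⟩
  -- the space side
  have H1 : ∀ x : Rn n, x ≠ 0 →
      IntegrableOn (fun t : ℝ => t ^ (a / 2 - 1) * Real.exp (-(‖x‖ ^ 2 * t))) (Set.Ioi 0) ∧
      ∫ t in Set.Ioi (0 : ℝ), t ^ (a / 2 - 1) * Real.exp (-(‖x‖ ^ 2 * t))
        = c₁ * ‖x‖ ^ (-a) := by
    intro x hx
    have hx0 : 0 < ‖x‖ := norm_pos_iff.2 hx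
    refine ⟨integrableOn_rpow_mul_exp_neg_mul (half_pos ha0) (by positivity), ?_⟩
    rw [Real.integral_rpow_mul_exp_neg_mul_Ioi (half_pos ha0) (by positivity), mul_comm]
    congr 1
    rw [one_div, Real.inv_rpow (by positivity), ← Real.rpow_natCast, ← Real.rpow_mul hx0.le,
      ← Real.rpow_neg hx0.le]
    congr 1
    push_cast
    ring
  have I1 := integral_superposition_mul (μ := volume.restrict (Set.Ioi (0 : ℝ)))
    (ν := (volume : Measure (Rn n)))
    (k := fun t x => t ^ (a / 2 - 1) * Real.exp (-(‖x‖ ^ 2 * t)))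
    (κ := fun x => c₁ * ‖x‖ ^ (-a)) (F := G) (by unfold Function.uncurry; fun_prop)
    (by
      filter_upwards [ae_restrict_mem measurableSet_Ioi] with t ht x
      have ht : 0 < t := ht
      positivity)
    (by filter_upwards [ae_ne_zero] with x hx using H1 x hx) hG
    (by simpa [mul_assoc] using hGi.const_mul (c₁ : ℂ))
  -- the frequency side
  have H2 : ∀ x : Rn n, x ≠ 0 →
      IntegrableOn (fun t : ℝ => Real.pi ^ ((n : ℝ) / 2) *
        (t ^ (-s - 1) * Real.exp (-(Real.pi ^ 2 * ‖x‖ ^ 2 / t)))) (Set.Ioi 0) ∧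
      ∫ t in Set.Ioi (0 : ℝ), Real.pi ^ ((n : ℝ) / 2) *
        (t ^ (-s - 1) * Real.exp (-(Real.pi ^ 2 * ‖x‖ ^ 2 / t))) = c₂ * ‖x‖ ^ (-(2 * s)) := by
    intro x hx
    have hx0 : 0 < ‖x‖ := norm_pos_iff.2 hx
    have hπ := Real.pi_pos
    obtain ⟨h1, h2⟩ := integral_rpow_mul_exp_neg_div (a := s) (r := Real.pi ^ 2 * ‖x‖ ^ 2) hs
      (by positivity)
    refine ⟨h1.const_mul _, ?_⟩
    rw [integral_const_mul, h2, hc₂, mul_assoc]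
    congr 1
    rw [mul_right_comm, one_div, one_div, mul_inv, Real.mul_rpow (by positivity) (by positivity)]
    congr 2
    rw [Real.inv_rpow (by positivity), ← Real.rpow_natCast, ← Real.rpow_mul hx0.le,
      ← Real.rpow_neg hx0.le]
    congr 1
  have I2 := integral_superposition_mul (μ := volume.restrict (Set.Ioi (0 : ℝ)))
    (ν := (volume : Measure (Rn n)))
    (k := fun t x => Real.pi ^ ((n : ℝ) / 2) *
        (t ^ (-s - 1) * Real.exp (-(Real.pi ^ 2 * ‖x‖ ^ 2 / t))))
    (κ := fun x => c₂ * ‖x‖ ^ (-(2 * s))) (F := γ) (by unfold Function.uncurry; fun_prop)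
    (by
      filter_upwards [ae_restrict_mem measurableSet_Ioi] with t ht x
      have ht : 0 < t := ht
      have := Real.pi_pos
      positivity)
    (by filter_upwards [ae_ne_zero] with x hx using H2 x hx) hγ.1
    (by simpa [mul_assoc] using hγi.const_mul (c₂ : ℂ))
  -- the two sides agree Gaussian by Gaussian
  have I3 : ∀ t ∈ Set.Ioi (0 : ℝ),
      ∫ w, ((t ^ (a / 2 - 1) * Real.exp (-(‖w‖ ^ 2 * t)) : ℝ) : ℂ) * G w
      = ∫ ξ : Rn n, ((Real.pi ^ ((n : ℝ) / 2) *
        (t ^ (-s - 1) * Real.exp (-(Real.pi ^ 2 * ‖ξ‖ ^ 2 / t))) : ℝ) : ℂ) * γ ξ := by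
    intro t ht
    have ht : 0 < t := ht
    have hgi : Integrable (fun w : Rn n => (Real.exp (-(‖w‖ ^ 2 * t)) : ℂ)) := by
      have h := GaussianFourier.integrable_cexp_neg_mul_sq_norm_add (V := Rn n) (b := (t : ℂ))
        (by simpa using ht) 0 0
      refine h.congr (.of_forall fun w => ?_)
      simp only [zero_mul, add_zero]
      push_cast
      congr 1
      ring
    have hprod : Integrable (fun p : Rn n × Rn n =>
        (Real.exp (-(‖p.1‖ ^ 2 * t)) : ℂ) * (γ p.2 * expChar p.1 p.2)) (volume.prod volume) := by
      have h := (hgi.mul_prod hγ).mul_bdd (c := 1) (g := fun p : Rn n × Rn n => expChar p.1 p.2)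
        continuous_expChar.aestronglyMeasurable (.of_forall fun p => (norm_expChar _ _).le)
      refine h.congr (.of_forall fun p => ?_)
      simp only [mul_assoc]
    have hswap := integral_integral_swap (f := fun w ξ : Rn n =>
        (Real.exp (-(‖w‖ ^ 2 * t)) : ℂ) * (γ ξ * expChar w ξ)) hprod
    have eL : ∀ w : Rn n, ((t ^ (a / 2 - 1) * Real.exp (-(‖w‖ ^ 2 * t)) : ℝ) : ℂ) * G w
        = ((t ^ (a / 2 - 1) : ℝ) : ℂ) * ∫ ξ,
          (Real.exp (-(‖w‖ ^ 2 * t)) : ℂ) * (γ ξ * expChar w ξ) := by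
      intro w
      rw [integral_const_mul, hGγ w]
      push_cast
      ring
    simp_rw [eL]
    rw [integral_const_mul, hswap, ← integral_const_mul]
    refine integral_congr_ae (.of_forall fun ξ => ?_)
    dsimp only
    have e3 : ∀ w : Rn n, (Real.exp (-(‖w‖ ^ 2 * t)) : ℂ) * (γ ξ * expChar w ξ)
        = γ ξ * ((Real.exp (-(‖w‖ ^ 2 * t)) : ℂ) * expChar w ξ) := fun w => by ring
    simp_rw [e3]
    rw [integral_const_mul, integral_gaussian_mul_expChar ht,
      show -s - 1 = (a / 2 - 1) + (-((n : ℝ) / 2)) by rw [ha]; ring, Real.rpow_add ht]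
    push_cast
    ring
  have I4 := setIntegral_congr_fun (μ := volume) measurableSet_Ioi I3
  rw [← I2, ← I1] at I4
  have hc₁' : (c₁ : ℂ) ≠ 0 := by exact_mod_cast hΓa.ne'
  push_cast at I4 ⊢
  simp_rw [mul_assoc] at I4
  rw [integral_const_mul, integral_const_mul] at I4
  rw [div_mul_eq_mul_div, eq_div_iff hc₁', mul_comm]
  exact I4

/-! ### The symbol of the fractional Laplacian -/

/-- The kernel `min (1, |h| ^ 2) / |h| ^ (n + 2s)`, which is integrable because `0 < s < 1`. -/
noncomputable def minKernel (s : ℝ) (h : Rn n) : ℝ :=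
  min 1 (‖h‖ ^ 2) * ‖h‖ ^ (-((n : ℝ) + 2 * s))

lemma minKernel_nonneg (s : ℝ) (h : Rn n) : 0 ≤ minKernel s h := by
  unfold minKernel; positivity

lemma measurable_minKernel (s : ℝ) : Measurable (minKernel s : Rn n → ℝ) := by
  unfold minKernel; fun_prop

lemma integrable_minKernel [NeZero n] {s : ℝ} (hs0 : 0 < s) (hs1 : s < 1) :
    Integrable (minKernel s : Rn n → ℝ) := by
  rw [← integrableOn_univ, ← Set.union_compl_self (Metric.ball (0 : Rn n) 1)]
  refine IntegrableOn.union ?_ ?_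
  · have h := integrableOn_ball_norm_rpow (n := n) (a := (n : ℝ) + 2 * s - 2) (by linarith) 1
    refine h.mono' (measurable_minKernel s).aestronglyMeasurable ?_
    refine .of_forall fun z => ?_
    rw [Real.norm_of_nonneg (minKernel_nonneg s z), minKernel]
    rcases eq_or_ne z 0 with rfl | hz
    · simp only [norm_zero]
      norm_num
      positivity
    have hz0 : 0 < ‖z‖ := norm_pos_iff.2 hz
    calc _ ≤ ‖z‖ ^ 2 * ‖z‖ ^ (-((n : ℝ) + 2 * s)) := by gcongr; exact min_le_right _ _
      _ = _ := by
        rw [← Real.rpow_natCast, ← Real.rpow_add hz0]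
        congr 1
        push_cast
        ring
  · have h := setLIntegral_powKernel_compl_ball_lt_top (n := n) (a := (n : ℝ) + 2 * s)
      (by linarith)
    refine ⟨(measurable_minKernel s).aestronglyMeasurable, ?_⟩
    refine lt_of_le_of_lt (lintegral_mono fun z => ?_) h
    rw [Real.enorm_of_nonneg (minKernel_nonneg s z)]
    refine ENNReal.ofReal_le_ofReal ?_
    rw [minKernel]
    exact mul_le_of_le_one_left (by positivity) (min_le_left _ _)

/-- The integrand of the Lévy–Khintchine formula for `|ξ| ^ (2s)`. -/
noncomputable def symbolIntegrand (s : ℝ) (ξ h : Rn n) : ℝ :=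
  2 * (1 - Real.cos (2 * Real.pi * inner ℝ h ξ)) * ‖h‖ ^ (-((n : ℝ) + 2 * s))

lemma symbolIntegrand_nonneg (s : ℝ) (ξ h : Rn n) : 0 ≤ symbolIntegrand s ξ h := by
  have := Real.cos_le_one (2 * Real.pi * inner ℝ h ξ)
  have h1 : 0 ≤ 1 - Real.cos (2 * Real.pi * inner ℝ h ξ) := by linarith
  unfold symbolIntegrand
  positivity

lemma integrable_symbolIntegrand [NeZero n] {s : ℝ} (hs0 : 0 < s) (hs1 : s < 1) (ξ : Rn n) :
    Integrable (symbolIntegrand s ξ) := by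
  refine ((integrable_minKernel hs0 hs1).const_mul (4 + 4 * Real.pi ^ 2 * ‖ξ‖ ^ 2)).mono'
    (by unfold symbolIntegrand; fun_prop) (.of_forall fun h => ?_)
  rw [Real.norm_of_nonneg (symbolIntegrand_nonneg s ξ h), symbolIntegrand, minKernel, ← mul_assoc]
  refine mul_le_mul_of_nonneg_right ?_ (by positivity)
  set θ := 2 * Real.pi * inner ℝ h ξ with hθ
  have h1 := Real.one_sub_sq_div_two_le_cos (x := θ)
  have h2 := Real.neg_one_le_cos θ
  have h3 : θ ^ 2 ≤ 4 * Real.pi ^ 2 * ‖ξ‖ ^ 2 * ‖h‖ ^ 2 := by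
    have h4 : (inner ℝ h ξ) ^ 2 ≤ (‖h‖ * ‖ξ‖) ^ 2 := by
      rw [← sq_abs]
      gcongr
      exact abs_real_inner_le_norm h ξ
    calc θ ^ 2 = 4 * Real.pi ^ 2 * (inner ℝ h ξ) ^ 2 := by rw [hθ]; ring
      _ ≤ 4 * Real.pi ^ 2 * (‖h‖ * ‖ξ‖) ^ 2 := by gcongr
      _ = _ := by ring
  have h5 : 0 ≤ 4 * Real.pi ^ 2 * ‖ξ‖ ^ 2 := by positivity
  rcases le_total 1 (‖h‖ ^ 2) with h6 | h6
  · rw [min_eq_left h6]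
    linarith
  · rw [min_eq_right h6]
    nlinarith [sq_nonneg ‖h‖]

/-- The Lévy–Khintchine formula for `|ξ| ^ (2s)`, by homogeneity and rotation invariance. -/
lemma exists_integral_symbolIntegrand [NeZero n] {s : ℝ} (hs0 : 0 < s) (hs1 : s < 1) :
    ∃ c : ℝ, 0 < c ∧ ∀ ξ : Rn n, ξ ≠ 0 → ∫ h, symbolIntegrand s ξ h = c * ‖ξ‖ ^ (2 * s) := by
  set e : Rn n := EuclideanSpace.single 0 1 with he
  have he1 : ‖e‖ = 1 := by simp [he]
  refine ⟨∫ h, symbolIntegrand s e h, ?_, fun ξ hξ => ?_⟩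
  · rw [integral_pos_iff_support_of_nonneg (symbolIntegrand_nonneg s e)
      (integrable_symbolIntegrand hs0 hs1 e)]
    set U : Set (Rn n) := {h | Real.cos (2 * Real.pi * inner ℝ h e) < 1}
    have hU : IsOpen U := isOpen_lt (by fun_prop) continuous_const
    have hUne : U.Nonempty := by
      refine ⟨(1 / 2 : ℝ) • e, ?_⟩
      have h1 : inner ℝ ((1 / 2 : ℝ) • e) e = 1 / 2 := by
        rw [real_inner_smul_left, real_inner_self_eq_norm_sq, he1]
        norm_num
      change Real.cos (2 * Real.pi * inner ℝ ((1 / 2 : ℝ) • e) e) < 1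
      rw [h1, show 2 * Real.pi * (1 / 2) = Real.pi by ring, Real.cos_pi]
      norm_num
    refine (hU.measure_pos volume hUne).trans_le (measure_mono fun h hh => ?_)
    have hh' : Real.cos (2 * Real.pi * inner ℝ h e) < 1 := hh
    have h0 : h ≠ 0 := by
      rintro rfl
      simp at hh'
    have h0' : 0 < ‖h‖ := norm_pos_iff.2 h0
    rw [Function.mem_support, symbolIntegrand]
    have : 0 < 1 - Real.cos (2 * Real.pi * inner ℝ h e) := by linarith
    positivity
  · have hr : 0 < ‖ξ‖ := norm_pos_iff.2 hξ
    set η : Rn n := ‖ξ‖⁻¹ • ξ with hη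
    have hη1 : ‖η‖ = 1 := by
      rw [hη, norm_smul, norm_inv, norm_norm, inv_mul_cancel₀ hr.ne']
    have hξη : ξ = ‖ξ‖ • η := by rw [hη, smul_smul, mul_inv_cancel₀ hr.ne', one_smul]
    have hrot : ∫ h, symbolIntegrand s η h = ∫ h, symbolIntegrand s e h := by
      -- the reflection that exchanges the unit vectors `η` and `e`
      set T := (ℝ ∙ (η - e))ᗮ.reflection with hT
      have hTη : T η = e := Submodule.reflection_sub (by rw [hη1, he1])
      rw [← (T.measurePreserving).integral_comp T.toHomeomorph.measurableEmbedding
        (symbolIntegrand s e)]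
      refine integral_congr_ae (.of_forall fun h => ?_)
      simp only [symbolIntegrand, LinearIsometryEquiv.norm_map]
      rw [← hTη, LinearIsometryEquiv.inner_map_map]
    have hscale := Measure.integral_comp_smul (volume : Measure (Rn n)) (symbolIntegrand s η) ‖ξ‖
    have hpt : ∀ h, symbolIntegrand s η (‖ξ‖ • h)
        = ‖ξ‖ ^ (-((n : ℝ) + 2 * s)) * symbolIntegrand s ξ h := by
      intro h
      simp only [symbolIntegrand]
      rw [norm_smul, norm_norm, Real.mul_rpow hr.le (norm_nonneg _), real_inner_smul_left,
        ← real_inner_smul_right, ← hξη]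
      ring
    simp_rw [hpt] at hscale
    rw [integral_const_mul, hrot, finrank_euclideanSpace, Fintype.card_fin,
      abs_of_pos (by positivity), smul_eq_mul, ← Real.rpow_natCast, ← Real.rpow_neg hr.le,
      Real.rpow_neg hr.le, inv_mul_eq_iff_eq_mul₀ (by positivity)] at hscale
    rw [hscale, ← mul_assoc, ← Real.rpow_add hr, mul_comm]
    congr 2
    ring

/-! ### Pairings of a Riesz potential with translates -/

/-- The power kernel is integrable on the unit ball and bounded by `1` outside it. -/
lemma lintegral_powKernel_mul_le {a : ℝ} (ha : 0 ≤ a) {f : Rn n → ℝ≥0∞} {M : ℝ≥0∞}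
    (hM : ∀ x, f x ≤ M) :
    ∫⁻ z, powKernel a z * f z
      ≤ (∫⁻ z in Metric.ball (0 : Rn n) 1, powKernel a z) * M + ∫⁻ z, f z := by
  rw [← lintegral_add_compl _ (measurableSet_ball (x := (0 : Rn n)) (ε := 1))]
  refine add_le_add ?_ ?_
  · rw [← lintegral_mul_const _ (measurable_powKernel a)]
    exact lintegral_mono fun z => by gcongr; exact hM z
  · refine (setLIntegral_mono' (g := f) measurableSet_ball.compl fun z hz => ?_).trans
      (setLIntegral_le_lintegral _ _)
    have hz1 : 1 ≤ ‖z‖ := by simpa using hz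
    have : powKernel a z ≤ 1 := by
      rw [powKernel, ← ENNReal.ofReal_one]
      exact ENNReal.ofReal_le_ofReal (Real.rpow_le_one_of_one_le_of_nonpos hz1 (by linarith))
    calc powKernel a z * f z ≤ 1 * f z := by gcongr
      _ = f z := one_mul _

lemma enorm_norm_rpow (a : ℝ) (z : Rn n) : ‖‖z‖ ^ (-a)‖ₑ = powKernel a z :=
  Real.enorm_of_nonneg (by positivity)

lemma integrable_norm_rpow_mul [NeZero n] {a : ℝ} (ha : 0 ≤ a) (han : a < n) {F : Rn n → ℂ}
    (hF : Integrable F) {M : ℝ} (hM : ∀ x, ‖F x‖ ≤ M) :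
    Integrable (fun z => ((‖z‖ ^ (-a) : ℝ) : ℂ) * F z) := by
  refine ⟨(by fun_prop : Measurable fun z : Rn n => ((‖z‖ ^ (-a) : ℝ) : ℂ)).aestronglyMeasurable.mul
    hF.1, ?_⟩
  have h := lintegral_powKernel_mul_le (a := a) ha (f := fun z => ‖F z‖ₑ) (M := ENNReal.ofReal M)
    fun x => by rw [← ofReal_norm]; exact ENNReal.ofReal_le_ofReal (hM x)
  have h2 := hF.2
  rw [hasFiniteIntegral_iff_enorm] at h2 ⊢
  refine lt_of_le_of_lt (lintegral_mono fun z => ?_) (h.trans_lt (ENNReal.add_lt_top.2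
    ⟨ENNReal.mul_lt_top (setLIntegral_powKernel_ball_lt_top han 1) ENNReal.ofReal_lt_top, h2⟩))
  rw [enorm_mul, ← enorm_norm_rpow, ← ofReal_norm, Complex.norm_real, ofReal_norm]

/-- The cross-correlation `z ↦ ∫ ψ(y) φ(y + z) dy`. -/
noncomputable def crossCorr (ψ φ : Rn n → ℝ) (z : Rn n) : ℝ := ∫ y, ψ y * φ (y + z)

/-- Fubini and the substitution `x = y + w` move the translate onto the cross-correlation. -/
lemma integral_rieszJ_mul_translate [NeZero n] {s : ℝ} (hs : 0 < s) (hn : 2 * s < n)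
    {ψ φ : Rn n → ℝ} (hψ : Integrable ψ) (hψm : Measurable ψ) (hφ : Integrable φ)
    (hφm : Measurable φ) {M : ℝ} (hM : ∀ x, ‖φ x‖ ≤ M) (h : Rn n) :
    ∫ x, rieszJ s ψ x * φ (x + h)
      = ∫ w, ‖w‖ ^ (-((n : ℝ) - 2 * s)) * crossCorr ψ φ (w + h) := by
  set a := (n : ℝ) - 2 * s with ha
  have ha0 : 0 ≤ a := by rw [ha]; linarith
  have han : a < n := by rw [ha]; linarith
  set K := (∫⁻ z in Metric.ball (0 : Rn n) 1, powKernel a z) * ENNReal.ofReal M + ∫⁻ z, ‖φ z‖ₑ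
  have hK : K < ⊤ := ENNReal.add_lt_top.2
    ⟨ENNReal.mul_lt_top (setLIntegral_powKernel_ball_lt_top han 1) ENNReal.ofReal_lt_top,
      hasFiniteIntegral_iff_enorm.1 hφ.2⟩
  have hbound : ∀ v : Rn n, ∫⁻ w, powKernel a w * ‖φ (w + v)‖ₑ ≤ K := by
    intro v
    refine (lintegral_powKernel_mul_le ha0 (f := fun z => ‖φ (z + v)‖ₑ) (M := ENNReal.ofReal M)
      fun x => ?_).trans (le_of_eq ?_)
    · rw [← ofReal_norm]
      exact ENNReal.ofReal_le_ofReal (hM _)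
    · rw [lintegral_add_right_eq_self (fun z => ‖φ z‖ₑ) v]
  have hψ2 : ∫⁻ y, ‖ψ y‖ₑ * K < ⊤ := by
    rw [lintegral_mul_const _ hψm.enorm]
    exact ENNReal.mul_lt_top (hasFiniteIntegral_iff_enorm.1 hψ.2) hK
  -- absolute convergence of the double integral, before and after the substitution `x = y + w`
  have hint1 : Integrable (fun p : Rn n × Rn n => ψ p.2 * ‖p.1 - p.2‖ ^ (-a) * φ (p.1 + h))
      (volume.prod volume) := by
    refine ⟨by fun_prop, ?_⟩
    rw [hasFiniteIntegral_iff_enorm, lintegral_prod_symm _ (by fun_prop)]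
    refine lt_of_le_of_lt (lintegral_mono fun y => ?_) hψ2
    simp only [enorm_mul, enorm_norm_rpow, mul_assoc]
    rw [lintegral_const_mul _ (by fun_prop)]
    gcongr
    rw [← lintegral_add_left_eq_self _ y]
    refine le_trans (le_of_eq (lintegral_congr fun w => ?_)) (hbound (y + h))
    rw [add_sub_cancel_left]
    congr 3
    abel
  have hint2 : Integrable (fun p : Rn n × Rn n => ψ p.2 * ‖p.1‖ ^ (-a) * φ (p.2 + (p.1 + h)))
      (volume.prod volume) := by
    refine ⟨by fun_prop, ?_⟩
    rw [hasFiniteIntegral_iff_enorm, lintegral_prod_symm _ (by fun_prop)]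
    refine lt_of_le_of_lt (lintegral_mono fun y => ?_) hψ2
    simp only [enorm_mul, enorm_norm_rpow, mul_assoc]
    rw [lintegral_const_mul _ (by fun_prop)]
    gcongr
    refine le_trans (le_of_eq (lintegral_congr fun w => ?_)) (hbound (y + h))
    congr 3
    abel
  calc ∫ x, rieszJ s ψ x * φ (x + h)
      = ∫ x, ∫ y, ψ y * ‖x - y‖ ^ (-a) * φ (x + h) := by
        refine integral_congr_ae (.of_forall fun x => ?_)
        dsimp only
        rw [rieszJ, ← integral_mul_const]
        refine integral_congr_ae (.of_forall fun y => ?_)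
        simp only [rieszIntegrand]
        rw [Real.rpow_neg (norm_nonneg _), div_eq_mul_inv]
    _ = ∫ y, ∫ x, ψ y * ‖x - y‖ ^ (-a) * φ (x + h) :=
        integral_integral_swap (f := fun x y => ψ y * ‖x - y‖ ^ (-a) * φ (x + h)) hint1
    _ = ∫ y, ∫ w, ψ y * ‖w‖ ^ (-a) * φ (y + (w + h)) := by
        refine integral_congr_ae (.of_forall fun y => ?_)
        dsimp only
        rw [← integral_add_left_eq_self _ y]
        refine integral_congr_ae (.of_forall fun w => ?_)
        dsimp only
        rw [add_sub_cancel_left, add_assoc]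
    _ = ∫ w, ∫ y, ψ y * ‖w‖ ^ (-a) * φ (y + (w + h)) :=
        (integral_integral_swap (f := fun w y => ψ y * ‖w‖ ^ (-a) * φ (y + (w + h))) hint2).symm
    _ = _ := by
        refine integral_congr_ae (.of_forall fun w => ?_)
        dsimp only
        rw [crossCorr, ← integral_const_mul]
        refine integral_congr_ae (.of_forall fun y => ?_)
        ring

/-! ### The weak equation for test functions -/

lemma crossCorr_eq_convolution (ψ φ : Rn n → ℝ) :
    crossCorr ψ φ = (fun y => ψ (-y)) ⋆[ContinuousLinearMap.mul ℝ ℝ, volume] φ := by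
  ext z
  rw [crossCorr, convolution_def, ← integral_neg_eq_self]
  refine integral_congr_ae (.of_forall fun y => ?_)
  simp only [ContinuousLinearMap.mul_apply']
  congr 2
  abel

/-- The cross-correlation of two test functions is a test function; it is encoded as a
complex-valued Schwartz function. -/
lemma exists_schwartzMap_crossCorr {ψ φ : Rn n → ℝ} (hψ : ContDiff ℝ ∞ ψ)
    (hψc : HasCompactSupport ψ) (hφ : ContDiff ℝ ∞ φ) (hφc : HasCompactSupport φ) :
    ∃ g : SchwartzMap (Rn n) ℂ, ∀ z, g z = (crossCorr ψ φ z : ℂ) := by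
  have hψn : Continuous fun y : Rn n => ψ (-y) := hψ.continuous.comp continuous_neg
  have hψnc : HasCompactSupport fun y : Rn n => ψ (-y) :=
    hψc.comp_homeomorph (Homeomorph.neg (Rn n))
  have h1 : ContDiff ℝ ∞ (crossCorr ψ φ) := by
    rw [crossCorr_eq_convolution]
    exact hφc.contDiff_convolution_right _ hψn.locallyIntegrable hφ
  have h2 : HasCompactSupport (crossCorr ψ φ) := by
    rw [crossCorr_eq_convolution]
    exact hψnc.convolution _ hφc
  have h3 : HasCompactSupport fun z => (crossCorr ψ φ z : ℂ) :=
    h2.comp_left (g := fun r : ℝ => (r : ℂ)) Complex.ofReal_zero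
  exact ⟨h3.toSchwartzMap (Complex.ofRealCLM.contDiff.comp h1), fun z => rfl⟩

lemma schwartzMap_eq_integral_fourier (g : SchwartzMap (Rn n) ℂ) (w : Rn n) :
    g w = ∫ ξ, (𝓕 g) ξ * expChar w ξ := by
  have h : 𝓕⁻ (𝓕 g) = g := by simp
  nth_rw 1 [← h]
  rw [SchwartzMap.fourierInv_coe, Real.fourierInv_eq']
  refine integral_congr_ae (.of_forall fun ξ => ?_)
  simp only [smul_eq_mul, expChar]
  rw [mul_comm, real_inner_comm]

lemma exists_bound_of_continuous_hasCompactSupport {φ : Rn n → ℝ} (hφ : Continuous φ)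
    (hφc : HasCompactSupport φ) : ∃ M : ℝ, 0 < M ∧ ∀ x, ‖φ x‖ ≤ M := by
  obtain ⟨M, hM⟩ := hφc.exists_bound_of_continuous hφ
  exact ⟨max M 1, by positivity, fun x => (hM x).trans (le_max_left _ _)⟩

lemma exists_schwartz_bound (g : SchwartzMap (Rn n) ℂ) : ∃ M : ℝ, ∀ x, ‖g x‖ ≤ M := by
  obtain ⟨M, -, hM⟩ := g.decay 0 0
  exact ⟨M, fun x => by simpa using hM x⟩

lemma exists_bound_rieszJ [NeZero n] {s : ℝ} (hs : 0 < s) (hn : 2 * s < n)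
    {ψ : Rn n → ℝ} (hψ : Continuous ψ) (hψc : HasCompactSupport ψ) :
    ∃ K : ℝ, ∀ x, rieszPot s (fun y => ‖ψ y‖ₑ) x ≤ ENNReal.ofReal K := by
  obtain ⟨M, hM0, hM⟩ := exists_bound_of_continuous_hasCompactSupport hψ hψc
  have hi : Integrable ψ := hψ.integrable_of_hasCompactSupport hψc
  set K := (∫⁻ z in Metric.ball (0 : Rn n) 1, powKernel ((n : ℝ) - 2 * s) z) * ENNReal.ofReal M
    + ∫⁻ z, ‖ψ z‖ₑ
  have hK : K < ⊤ := ENNReal.add_lt_top.2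
    ⟨ENNReal.mul_lt_top (setLIntegral_powKernel_ball_lt_top (by linarith) 1) ENNReal.ofReal_lt_top,
      hasFiniteIntegral_iff_enorm.1 hi.2⟩
  refine ⟨K.toReal, fun x => ?_⟩
  rw [ENNReal.ofReal_toReal hK.ne, rieszPot, ← lintegral_sub_left_eq_self _ x]
  simp only [sub_sub_cancel]
  calc _ = ∫⁻ z, powKernel ((n : ℝ) - 2 * s) z * ‖ψ (x - z)‖ₑ :=
        lintegral_congr fun z => mul_comm _ _
    _ ≤ _ := lintegral_powKernel_mul_le (by linarith) (M := ENNReal.ofReal M) fun z => by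
        rw [← ofReal_norm]
        exact ENNReal.ofReal_le_ofReal (hM _)
    _ = K := by rw [lintegral_sub_left_eq_self (fun z => ‖ψ z‖ₑ) x]

/-- Expansion of the product of differences; the terms with `u (x + h)` are translated back to
pairings of `u` with translates of `φ`. -/
lemma integral_diff_mul_diff {u φ : Rn n → ℝ} (hu : Measurable u) {K : ℝ} (hK : ∀ x, ‖u x‖ ≤ K)
    (hφ : Integrable φ) (h : Rn n) :
    ∫ x, (u x - u (x + h)) * (φ x - φ (x + h))
      = 2 * (∫ x, u x * φ (x + 0)) - (∫ x, u x * φ (x + h)) - ∫ x, u x * φ (x + -h) := by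
  have i1 : Integrable fun x => u x * φ x :=
    hφ.bdd_mul hu.aestronglyMeasurable (.of_forall hK)
  have i2 : Integrable fun x => u x * φ (x + h) :=
    (hφ.comp_add_right h).bdd_mul hu.aestronglyMeasurable (.of_forall hK)
  have i3 : Integrable fun x => u (x + h) * φ x :=
    hφ.bdd_mul (hu.comp (measurable_add_const h)).aestronglyMeasurable
      (.of_forall fun x => hK (x + h))
  have i4 : Integrable fun x => u (x + h) * φ (x + h) := i1.comp_add_right h
  have i12 : Integrable fun x => u x * φ x - u x * φ (x + h) := i1.sub i2
  have i123 : Integrable fun x => u x * φ x - u x * φ (x + h) - u (x + h) * φ x := i12.sub i3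
  have e3 : ∫ x, u (x + h) * φ x = ∫ x, u x * φ (x + -h) := by
    rw [← integral_add_right_eq_self (fun x => u x * φ (x + -h)) h]
    simp
  have e4 : ∫ x, u (x + h) * φ (x + h) = ∫ x, u x * φ x :=
    integral_add_right_eq_self (fun x => u x * φ x) h
  calc ∫ x, (u x - u (x + h)) * (φ x - φ (x + h))
      = ∫ x, ((u x * φ x - u x * φ (x + h)) - u (x + h) * φ x + u (x + h) * φ (x + h)) :=
        integral_congr_ae (.of_forall fun x => by ring)
    _ = _ := by
        rw [integral_add i123 i4, integral_sub i12 i3,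
          integral_sub i1 i2, e3, e4]
        simp only [add_zero]
        ring

/-- The form after the measure-preserving substitution `y = x + h`. -/
lemma integral_formIntegrand_eq {s : ℝ} {u φ : Rn n → ℝ}
    (hint : Integrable (formIntegrand s u φ) (volume.prod volume)) :
    ∫ p, formIntegrand s u φ p ∂(volume.prod volume)
      = ∫ h : Rn n, ‖h‖ ^ (-((n : ℝ) + 2 * s)) * ∫ x, (u x - u (x + h)) * (φ x - φ (x + h)) := by
  have hmp : MeasurePreserving (MeasurableEquiv.shearAddRight (Rn n))
      (volume.prod volume) (volume.prod volume) := measurePreserving_prod_add volume volume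
  rw [← hmp.integral_comp' (formIntegrand s u φ), integral_prod_symm]
  · refine integral_congr_ae (.of_forall fun h => ?_)
    dsimp only
    rw [← integral_const_mul]
    refine integral_congr_ae (.of_forall fun x => ?_)
    change formIntegrand s u φ (x, x + h) = _
    simp only [formIntegrand]
    rw [sub_add_cancel_left, norm_neg, Real.rpow_neg (norm_nonneg _), div_eq_inv_mul]
  · exact hmp.integrable_comp_of_integrable hint

/-- The weak equation for test functions. With `g` the cross-correlation of `ψ` and `φ`, the form
is `∫ |h| ^ (-n-2s) (2 A(0) - A(h) - A(-h)) dh` with `A(h) = ∫ |w| ^ (2s-n) g(w + h) dw`; in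
frequency space the two powers cancel and `∫ ĝ = g(0) = ∫ ψ φ` is left. -/
lemma exists_integral_formIntegrand_rieszJ [NeZero n] {s : ℝ} (hs0 : 0 < s) (hs1 : s < 1)
    (hn : 2 * s < n) :
    ∃ c : ℝ, 0 < c ∧ ∀ ψ φ : Rn n → ℝ, ContDiff ℝ ∞ ψ → HasCompactSupport ψ →
      ContDiff ℝ ∞ φ → HasCompactSupport φ →
      Integrable (formIntegrand s (rieszJ s ψ) φ) (volume.prod volume) →
      ∫ p, formIntegrand s (rieszJ s ψ) φ p ∂(volume.prod volume) = c * ∫ x, ψ x * φ x := by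
  obtain ⟨c₁, hc₁, H1⟩ := exists_integral_symbolIntegrand (n := n) hs0 hs1
  obtain ⟨c₂, hc₂, H2⟩ := exists_integral_rpow_mul_eq (n := n) hs0 hn
  refine ⟨c₂ * c₁, by positivity, fun ψ φ hψ hψc hφ hφc hint => ?_⟩
  obtain ⟨g, hg⟩ := exists_schwartzMap_crossCorr hψ hψc hφ hφc
  set a := (n : ℝ) - 2 * s with ha
  set γ : Rn n → ℂ := fun ξ => (𝓕 g) ξ with hγdef
  have hγ : Integrable γ := (𝓕 g).integrable
  have hγi : Integrable fun ξ => ((‖ξ‖ ^ (-(2 * s)) : ℝ) : ℂ) * γ ξ := by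
    obtain ⟨M, hM⟩ := exists_schwartz_bound (𝓕 g)
    exact integrable_norm_rpow_mul (by positivity) hn hγ hM
  have hφi : Integrable φ := hφ.continuous.integrable_of_hasCompactSupport hφc
  have hψi : Integrable ψ := hψ.continuous.integrable_of_hasCompactSupport hψc
  obtain ⟨M, -, hM⟩ := exists_bound_of_continuous_hasCompactSupport hφ.continuous hφc
  obtain ⟨K, hK⟩ := exists_bound_rieszJ hs0 hn hψ.continuous hψc
  have hum : Measurable (rieszJ s ψ) := measurable_rieszJ hψ.continuous.aestronglyMeasurable
  have huK : ∀ x, ‖rieszJ s ψ x‖ ≤ max K 0 := by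
    intro x
    have h := (enorm_rieszJ_le s ψ x).trans (hK x)
    rw [← ofReal_norm] at h
    by_contra! hcon
    rw [max_lt_iff] at hcon
    rw [ENNReal.ofReal_le_ofReal_iff'] at h
    rcases h with h | h <;> linarith
  -- the pairing with a translate, in frequency space
  have hA : ∀ h : Rn n, ((∫ x, rieszJ s ψ x * φ (x + h) : ℝ) : ℂ)
      = c₂ * ∫ ξ, ((‖ξ‖ ^ (-(2 * s)) : ℝ) : ℂ) * γ ξ * expChar h ξ := by
    intro h
    have hEm : AEStronglyMeasurable (fun ξ : Rn n => expChar h ξ) volume :=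
      (continuous_expChar.comp (by fun_prop : Continuous fun ξ : Rn n => (h, ξ))).aestronglyMeasurable
    have hb : ∀ᵐ ξ : Rn n, ‖expChar h ξ‖ ≤ 1 := .of_forall fun ξ => (norm_expChar _ _).le
    have hgi : Integrable fun w => g (w + h) := g.integrable.comp_add_right h
    have h2 := H2 (fun ξ => γ ξ * expChar h ξ) (fun w => g (w + h)) (hγ.mul_bdd hEm hb) hgi.1
      (fun w => by
        rw [schwartzMap_eq_integral_fourier g (w + h)]
        refine integral_congr_ae (.of_forall fun ξ => ?_)
        simp only [hγdef]
        rw [expChar_add]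
        ring)
      (by simpa only [mul_assoc] using hγi.mul_bdd hEm hb)
      (by
        obtain ⟨M', hM'⟩ := exists_schwartz_bound g
        exact integrable_norm_rpow_mul (by linarith) (by linarith) hgi fun x => hM' _)
    rw [integral_rieszJ_mul_translate hs0 hn hψi hψ.continuous.measurable hφi
      hφ.continuous.measurable hM h, ← integral_complex_ofReal]
    simp only [Complex.ofReal_mul]
    simp_rw [hg] at h2
    rw [h2]
    simp only [mul_assoc]
  have hE : ∀ h : Rn n, Integrable fun ξ => ((‖ξ‖ ^ (-(2 * s)) : ℝ) : ℂ) * γ ξ * expChar h ξ :=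
    fun h => hγi.mul_bdd (continuous_expChar.comp
      (by fun_prop : Continuous fun ξ : Rn n => (h, ξ))).aestronglyMeasurable
      (.of_forall fun ξ => (norm_expChar _ _).le)
  have hD : ∀ h : Rn n, ((‖h‖ ^ (-((n : ℝ) + 2 * s)) *
      ∫ x, (rieszJ s ψ x - rieszJ s ψ (x + h)) * (φ x - φ (x + h)) : ℝ) : ℂ)
      = c₂ * ∫ ξ, (symbolIntegrand s ξ h : ℂ) * (((‖ξ‖ ^ (-(2 * s)) : ℝ) : ℂ) * γ ξ) := by
    intro h
    rw [integral_diff_mul_diff hum huK hφi h]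
    push_cast
    rw [hA, hA, hA]
    have e : ∀ ξ : Rn n, (symbolIntegrand s ξ h : ℂ) * (((‖ξ‖ ^ (-(2 * s)) : ℝ) : ℂ) * γ ξ)
        = ((‖h‖ ^ (-((n : ℝ) + 2 * s)) : ℝ) : ℂ)
          * (2 * (((‖ξ‖ ^ (-(2 * s)) : ℝ) : ℂ) * γ ξ * expChar 0 ξ)
            - ((‖ξ‖ ^ (-(2 * s)) : ℝ) : ℂ) * γ ξ * expChar h ξ
            - ((‖ξ‖ ^ (-(2 * s)) : ℝ) : ℂ) * γ ξ * expChar (-h) ξ) := by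
      intro ξ
      have h0 : expChar 0 ξ = 1 := by simp [expChar]
      have hc : expChar (-h) ξ
          = ((2 * Real.cos (2 * Real.pi * inner ℝ h ξ) : ℝ) : ℂ) - expChar h ξ := by
        rw [← expChar_add_expChar_neg]
        ring
      rw [h0, hc, symbolIntegrand]
      push_cast
      ring
    simp_rw [e]
    have j0 := (hE 0).const_mul 2
    have j1 : Integrable fun ξ => 2 * (((‖ξ‖ ^ (-(2 * s)) : ℝ) : ℂ) * γ ξ * expChar 0 ξ)
        - ((‖ξ‖ ^ (-(2 * s)) : ℝ) : ℂ) * γ ξ * expChar h ξ := j0.sub (hE h)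
    rw [integral_const_mul, integral_sub j1 (hE (-h)), integral_sub j0 (hE h), integral_const_mul]
    ring
  have hcancel : ∀ ξ : Rn n, ξ ≠ 0 →
      ((c₁ * ‖ξ‖ ^ (2 * s) : ℝ) : ℂ) * (((‖ξ‖ ^ (-(2 * s)) : ℝ) : ℂ) * γ ξ) = c₁ * γ ξ := by
    intro ξ hξ
    rw [← mul_assoc, ← Complex.ofReal_mul, mul_assoc, ← Real.rpow_add (norm_pos_iff.2 hξ),
      add_neg_cancel, Real.rpow_zero, mul_one]
  have hcancel' : (fun ξ => ((c₁ * ‖ξ‖ ^ (2 * s) : ℝ) : ℂ) * (((‖ξ‖ ^ (-(2 * s)) : ℝ) : ℂ) * γ ξ))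
      =ᵐ[volume] fun ξ => c₁ * γ ξ := by
    filter_upwards [ae_ne_zero] with ξ hξ using hcancel ξ hξ
  have hsup := integral_superposition_mul (μ := (volume : Measure (Rn n)))
    (ν := (volume : Measure (Rn n))) (k := fun h ξ => symbolIntegrand s ξ h)
    (κ := fun ξ => c₁ * ‖ξ‖ ^ (2 * s)) (F := fun ξ => ((‖ξ‖ ^ (-(2 * s)) : ℝ) : ℂ) * γ ξ)
    (by unfold Function.uncurry symbolIntegrand; fun_prop)
    (.of_forall fun h ξ => symbolIntegrand_nonneg s ξ h)
    (by
      filter_upwards [ae_ne_zero] with ξ hξ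
      exact ⟨integrable_symbolIntegrand hs0 hs1 ξ, H1 ξ hξ⟩)
    hγi.1 ((hγ.const_mul (c₁ : ℂ)).congr hcancel'.symm)
  rw [integral_congr_ae hcancel', integral_const_mul] at hsup
  have hγ0 : ∫ ξ, γ ξ = ((∫ x, ψ x * φ x : ℝ) : ℂ) := by
    have h := schwartzMap_eq_integral_fourier g 0
    have h0 : ∀ ξ : Rn n, expChar 0 ξ = 1 := fun ξ => by simp [expChar]
    simp only [h0, mul_one] at h
    rw [← h, hg, crossCorr]
    simp
  rw [integral_formIntegrand_eq hint]
  have hfin : ((∫ h : Rn n, ‖h‖ ^ (-((n : ℝ) + 2 * s)) *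
      ∫ x, (rieszJ s ψ x - rieszJ s ψ (x + h)) * (φ x - φ (x + h)) : ℝ) : ℂ)
      = ((c₂ * c₁ * ∫ x, ψ x * φ x : ℝ) : ℂ) := by
    rw [← integral_complex_ofReal]
    simp_rw [hD]
    rw [integral_const_mul, ← hsup, hγ0]
    push_cast
    ring
  exact_mod_cast hfin

/-! ### The Gagliardo seminorm as an `L²` norm -/

/-- The difference quotient whose `L²` norm is the Gagliardo seminorm. -/
noncomputable def gagQuot (s : ℝ) (u : Rn n → ℝ) (p : Rn n × Rn n) : ℝ :=
  (u p.1 - u p.2) / ‖p.1 - p.2‖ ^ (((n : ℝ) + 2 * s) / 2)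

lemma rpow_half_sq {x : ℝ} (hx : 0 ≤ x) (α : ℝ) : (x ^ (α / 2)) ^ 2 = x ^ α := by
  rw [← Real.rpow_natCast, ← Real.rpow_mul hx]
  congr 1
  push_cast
  ring

lemma sq_gagQuot (s : ℝ) (u : Rn n → ℝ) (p : Rn n × Rn n) :
    gagQuot s u p ^ 2 = |u p.1 - u p.2| ^ 2 / ‖p.1 - p.2‖ ^ ((n : ℝ) + 2 * s) := by
  rw [gagQuot, div_pow, rpow_half_sq (norm_nonneg _), sq_abs]

lemma gagQuot_mul_gagQuot (s : ℝ) (u φ : Rn n → ℝ) (p : Rn n × Rn n) :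
    gagQuot s u p * gagQuot s φ p = formIntegrand s u φ p := by
  rw [gagQuot, gagQuot, div_mul_div_comm, ← sq, rpow_half_sq (norm_nonneg _), formIntegrand]

lemma gagliardo_eq_eLpNorm (s : ℝ) (u : Rn n → ℝ) :
    gagliardo s u = eLpNorm (gagQuot s u) 2 (volume.prod volume) := by
  rw [eLpNorm_eq_lintegral_rpow_enorm_toReal two_ne_zero ENNReal.ofNat_ne_top, gagliardo]
  simp only [ENNReal.toReal_ofNat]
  congr 1
  refine lintegral_congr fun p => ?_
  rw [← sq_gagQuot, ← sq_abs, ENNReal.ofReal_pow (abs_nonneg _), ← Real.enorm_eq_ofReal_abs]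
  norm_cast

lemma aestronglyMeasurable_gagQuot (s : ℝ) {u : Rn n → ℝ} (hu : AEStronglyMeasurable u volume) :
    AEStronglyMeasurable (gagQuot s u) (volume.prod volume) := by
  refine AEStronglyMeasurable.mul (hu.comp_fst.sub hu.comp_snd) ?_
  exact (by fun_prop : Measurable fun p : Rn n × Rn n =>
    (‖p.1 - p.2‖ ^ (((n : ℝ) + 2 * s) / 2))⁻¹).aestronglyMeasurable

lemma memLp_gagQuot {s : ℝ} {u : Rn n → ℝ} (hu : AEStronglyMeasurable u volume)
    (h : gagliardo s u < ⊤) : MemLp (gagQuot s u) 2 (volume.prod volume) :=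
  ⟨aestronglyMeasurable_gagQuot s hu, by rwa [← gagliardo_eq_eLpNorm]⟩

lemma gagliardo_add_le (s : ℝ) {u v : Rn n → ℝ} (hu : AEStronglyMeasurable u volume)
    (hv : AEStronglyMeasurable v volume) :
    gagliardo s (fun x => u x + v x) ≤ gagliardo s u + gagliardo s v := by
  simp only [gagliardo_eq_eLpNorm]
  refine le_trans (le_of_eq ?_) (eLpNorm_add_le (aestronglyMeasurable_gagQuot s hu)
    (aestronglyMeasurable_gagQuot s hv) one_le_two)
  congr 1
  ext p
  simp only [gagQuot, Pi.add_apply]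
  ring

lemma gagQuot_congr_ae (s : ℝ) {u v : Rn n → ℝ} (h : u =ᵐ[volume] v) :
    gagQuot s u =ᵐ[volume.prod volume] gagQuot s v := by
  have h1 : ∀ᵐ p : Rn n × Rn n ∂(volume.prod volume), u p.1 = v p.1 :=
    Measure.quasiMeasurePreserving_fst.ae h
  have h2 : ∀ᵐ p : Rn n × Rn n ∂(volume.prod volume), u p.2 = v p.2 :=
    Measure.quasiMeasurePreserving_snd.ae h
  filter_upwards [h1, h2] with p hp1 hp2
  rw [gagQuot, gagQuot, hp1, hp2]

lemma gagliardo_congr_ae (s : ℝ) {u v : Rn n → ℝ} (h : u =ᵐ[volume] v) :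
    gagliardo s u = gagliardo s v := by
  rw [gagliardo_eq_eLpNorm, gagliardo_eq_eLpNorm, eLpNorm_congr_ae (gagQuot_congr_ae s h)]

lemma integrable_formIntegrand {s : ℝ} {u φ : Rn n → ℝ} (hu : AEStronglyMeasurable u volume)
    (hφ : AEStronglyMeasurable φ volume) (hu' : gagliardo s u < ⊤) (hφ' : gagliardo s φ < ⊤) :
    Integrable (formIntegrand s u φ) (volume.prod volume) := by
  refine ((memLp_gagQuot hu hu').integrable_mul (memLp_gagQuot hφ hφ')).congr ?_
  exact .of_forall fun p => gagQuot_mul_gagQuot s u φ p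

/-- The Cauchy–Schwarz inequality for the form. -/
lemma enorm_integral_formIntegrand_le {s : ℝ} {u φ : Rn n → ℝ}
    (hu : AEStronglyMeasurable u volume) (hφ : AEStronglyMeasurable φ volume) :
    ‖∫ p, formIntegrand s u φ p ∂(volume.prod volume)‖ₑ ≤ gagliardo s u * gagliardo s φ := by
  refine (enorm_integral_le_lintegral_enorm _).trans ?_
  rw [gagliardo_eq_eLpNorm, gagliardo_eq_eLpNorm,
    eLpNorm_eq_lintegral_rpow_enorm_toReal two_ne_zero ENNReal.ofNat_ne_top,
    eLpNorm_eq_lintegral_rpow_enorm_toReal two_ne_zero ENNReal.ofNat_ne_top]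
  refine le_trans (le_of_eq (lintegral_congr fun p => ?_))
    (ENNReal.lintegral_mul_le_Lp_mul_Lq (p := 2) (q := 2) _ (by norm_num [Real.holderConjugate_iff])
      (aestronglyMeasurable_gagQuot s hu).aemeasurable.enorm
      (aestronglyMeasurable_gagQuot s hφ).aemeasurable.enorm)
  rw [← gagQuot_mul_gagQuot, enorm_mul]
  rfl

/-! ### Finiteness of the seminorm under decay -/

lemma minKernel_neg (s : ℝ) (h : Rn n) : minKernel s (-h) = minKernel s h := by
  simp [minKernel]

lemma integrable_mul_minKernel_snd [NeZero n] {s : ℝ} (hs0 : 0 < s) (hs1 : s < 1) {F : Rn n → ℝ}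
    (hF : Integrable F) :
    Integrable (fun p : Rn n × Rn n => F p.2 * minKernel s (p.1 - p.2)) (volume.prod volume) :=
  hF.convolution_integrand (ContinuousLinearMap.mul ℝ ℝ) (integrable_minKernel hs0 hs1)

lemma integrable_mul_minKernel_fst [NeZero n] {s : ℝ} (hs0 : 0 < s) (hs1 : s < 1) {F : Rn n → ℝ}
    (hF : Integrable F) :
    Integrable (fun p : Rn n × Rn n => F p.1 * minKernel s (p.1 - p.2)) (volume.prod volume) := by
  refine (integrable_mul_minKernel_snd hs0 hs1 hF).swap.congr (.of_forall fun p => ?_)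
  simp only [Function.comp_apply, Prod.fst_swap, Prod.snd_swap]
  rw [← minKernel_neg, neg_sub]

lemma gagliardo_lt_top_of_sq_le [NeZero n] {s : ℝ} (hs0 : 0 < s) (hs1 : s < 1)
    {u F : Rn n → ℝ} (hF : Integrable F)
    (h : ∀ x y, (u x - u y) ^ 2 ≤ (F x + F y) * min 1 (‖x - y‖ ^ 2)) : gagliardo s u < ⊤ := by
  rw [gagliardo]
  refine ENNReal.rpow_lt_top_of_nonneg (by norm_num) (lt_top_iff_ne_top.1 ?_)
  have hi := (integrable_mul_minKernel_fst hs0 hs1 hF).add (integrable_mul_minKernel_snd hs0 hs1 hF)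
  refine lt_of_le_of_lt (lintegral_mono fun p => ENNReal.ofReal_le_ofReal ?_) hi.lintegral_lt_top
  simp only [Pi.add_apply]
  rw [sq_abs, div_eq_mul_inv, ← Real.rpow_neg (norm_nonneg _), ← add_mul, minKernel, ← mul_assoc]
  exact mul_le_mul_of_nonneg_right (h p.1 p.2) (by positivity)

lemma integrable_sq_decay {r : ℝ} (hr : (n : ℝ) < 2 * r) (C : ℝ) :
    Integrable fun x : Rn n => C * ((1 + ‖x‖) ^ (-r)) ^ 2 := by
  have h : Integrable fun x : Rn n => (1 + ‖x‖) ^ (-(2 * r)) :=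
    integrable_one_add_norm (by simpa using hr)
  refine (h.const_mul C).congr (.of_forall fun x => ?_)
  dsimp only
  rw [← Real.rpow_natCast, ← Real.rpow_mul (by positivity)]
  congr 2
  push_cast
  ring

lemma memLp_two_of_decay {r C : ℝ} (hr : (n : ℝ) < 2 * r) {u : Rn n → ℝ}
    (hu : AEStronglyMeasurable u volume) (h1 : ∀ x, |u x| ≤ C * (1 + ‖x‖) ^ (-r)) :
    MemLp u 2 volume := by
  rw [memLp_two_iff_integrable_sq hu]
  refine (integrable_sq_decay hr (C ^ 2)).mono' (hu.pow 2) (.of_forall fun x => ?_)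
  rw [Real.norm_of_nonneg (sq_nonneg _), ← sq_abs, ← mul_pow]
  exact pow_le_pow_left₀ (abs_nonneg _) (h1 x) 2

lemma gagliardo_lt_top_of_decay [NeZero n] {s : ℝ} (hs0 : 0 < s) (hs1 : s < 1) {r C : ℝ}
    (hr : (n : ℝ) < 2 * r) {u : Rn n → ℝ} (h1 : ∀ x, |u x| ≤ C * (1 + ‖x‖) ^ (-r))
    (h2 : ∀ x y, ‖x - y‖ ≤ 1 → |u x - u y| ≤ C * ‖x - y‖ * (1 + ‖x‖) ^ (-r)) :
    gagliardo s u < ⊤ := by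
  refine gagliardo_lt_top_of_sq_le hs0 hs1 (integrable_sq_decay hr (2 * C ^ 2)) fun x y => ?_
  set X := (1 + ‖x‖) ^ (-r)
  set Y := (1 + ‖y‖) ^ (-r)
  have hX : 0 ≤ C ^ 2 * X ^ 2 := by positivity
  have hY : 0 ≤ C ^ 2 * Y ^ 2 := by positivity
  rcases le_or_gt ‖x - y‖ 1 with hxy | hxy
  · rw [min_eq_right (pow_le_one₀ (norm_nonneg _) hxy)]
    calc (u x - u y) ^ 2 ≤ (C * ‖x - y‖ * X) ^ 2 := by
          rw [← sq_abs]
          exact pow_le_pow_left₀ (abs_nonneg _) (h2 x y hxy) 2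
      _ = C ^ 2 * X ^ 2 * ‖x - y‖ ^ 2 := by ring
      _ ≤ _ := by gcongr; linarith
  · rw [min_eq_left (one_le_pow₀ hxy.le), mul_one]
    have hx : u x ^ 2 ≤ (C * X) ^ 2 := by
      rw [← sq_abs]
      exact pow_le_pow_left₀ (abs_nonneg _) (h1 x) 2
    have hy : u y ^ 2 ≤ (C * Y) ^ 2 := by
      rw [← sq_abs]
      exact pow_le_pow_left₀ (abs_nonneg _) (h1 y) 2
    nlinarith [sq_nonneg (u x + u y)]

/-! ### Truncation by cutoff functions -/

lemma exists_cutoff (n : ℕ) : ∃ L : ℝ, 1 ≤ L ∧ ∃ χ : ℕ → Rn n → ℝ,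
    (∀ k, ContDiff ℝ ∞ (χ k)) ∧ (∀ k, HasCompactSupport (χ k)) ∧
    (∀ k x, 0 ≤ χ k x) ∧ (∀ k x, χ k x ≤ 1) ∧ (∀ (k : ℕ) x, ‖x‖ ≤ k → χ k x = 1) ∧
    ∀ k x y, |χ k x - χ k y| ≤ L * ‖x - y‖ := by
  let b : ContDiffBump (0 : Rn n) := ⟨1, 2, one_pos, one_lt_two⟩
  obtain ⟨K, hK⟩ := ContDiff.lipschitzWith_of_hasCompactSupport (𝕂 := ℝ) b.hasCompactSupport
    (b.contDiff (n := 1)) one_ne_zero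
  have hk1 : ∀ k : ℕ, (1 : ℝ) ≤ (k : ℝ) + 1 := fun k => by simp
  refine ⟨max 1 K, le_max_left _ _, fun k x => b (((k : ℝ) + 1)⁻¹ • x), fun k => ?_, fun k => ?_,
    fun k x => b.nonneg, fun k x => b.le_one, fun k x hx => ?_, fun k x y => ?_⟩
  · exact b.contDiff.comp (contDiff_const_smul _)
  · have hk : ((k : ℝ) + 1)⁻¹ ≠ 0 := by positivity
    exact b.hasCompactSupport.comp_homeomorph (Homeomorph.smulOfNeZero _ hk)
  · refine b.one_of_mem_closedBall ?_
    rw [mem_closedBall_zero_iff, norm_smul, norm_inv, Real.norm_of_nonneg (by positivity),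
      inv_mul_le_iff₀ (by positivity)]
    change ‖x‖ ≤ ((k : ℝ) + 1) * 1
    linarith
  · have h := hK.dist_le_mul (((k : ℝ) + 1)⁻¹ • x) (((k : ℝ) + 1)⁻¹ • y)
    rw [Real.dist_eq, dist_eq_norm, ← smul_sub, norm_smul, norm_inv,
      Real.norm_of_nonneg (by positivity : (0 : ℝ) ≤ (k : ℝ) + 1)] at h
    refine h.trans ?_
    gcongr
    · exact le_max_right _ _
    · exact mul_le_of_le_one_left (norm_nonneg _) (inv_le_one_of_one_le₀ (hk1 k))

/-- Truncation converges in the seminorm. The commutator with the cutoff is dominated by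
`u(y)² min (1, |x - y|²) / |x - y| ^ (n + 2s)`, which is integrable since `u ∈ L²`. -/
lemma tendsto_gagliardo_cutoff [NeZero n] {s : ℝ} (hs0 : 0 < s) (hs1 : s < 1) {u : Rn n → ℝ}
    (hum : Measurable u) (hu2 : MemLp u 2 volume) (hug : gagliardo s u < ⊤) {L : ℝ} (hL : 1 ≤ L)
    {χ : ℕ → Rn n → ℝ} (hχm : ∀ k, Measurable (χ k)) (h0 : ∀ k x, 0 ≤ χ k x)
    (h1 : ∀ k x, χ k x ≤ 1) (hone : ∀ (k : ℕ) x, ‖x‖ ≤ k → χ k x = 1)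
    (hlip : ∀ k x y, |χ k x - χ k y| ≤ L * ‖x - y‖) :
    Tendsto (fun k => gagliardo s fun x => u x - χ k x * u x) atTop (𝓝 0) := by
  have hq := (memLp_two_iff_integrable_sq (aestronglyMeasurable_gagQuot s
    hum.aestronglyMeasurable)).1 (memLp_gagQuot hum.aestronglyMeasurable hug)
  have hu2' := (memLp_two_iff_integrable_sq hum.aestronglyMeasurable).1 hu2
  have hB := (hq.const_mul 2).add ((integrable_mul_minKernel_snd hs0 hs1 hu2').const_mul (2 * L ^ 2))
  have hlim := tendsto_lintegral_of_dominated_convergence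
    (μ := (volume : Measure (Rn n)).prod volume)
    (F := fun (k : ℕ) (p : Rn n × Rn n) => ENNReal.ofReal
      (|(u p.1 - χ k p.1 * u p.1) - (u p.2 - χ k p.2 * u p.2)| ^ 2
        / ‖p.1 - p.2‖ ^ ((n : ℝ) + 2 * s))) (f := fun _ => 0)
    (fun p => ENNReal.ofReal (2 * gagQuot s u p ^ 2
      + 2 * L ^ 2 * (u p.2 ^ 2 * minKernel s (p.1 - p.2))))
    (fun k => by have := hχm k; fun_prop)
    (fun k => .of_forall fun p => ENNReal.ofReal_le_ofReal ?_)
    hB.lintegral_lt_top.ne (.of_forall fun p => ?_)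
  · simp only [lintegral_zero] at hlim
    have := ((ENNReal.continuous_rpow_const (y := (1 / 2 : ℝ))).tendsto 0).comp hlim
    rw [ENNReal.zero_rpow_of_pos (by norm_num)] at this
    exact this
  · rw [sq_gagQuot, sq_abs, sq_abs, minKernel, div_eq_mul_inv, div_eq_mul_inv,
      ← Real.rpow_neg (norm_nonneg _)]
    set x := p.1
    set y := p.2
    set k' := ‖x - y‖ ^ (-((n : ℝ) + 2 * s))
    have hk' : 0 ≤ k' := by positivity
    have hc : (χ k x - χ k y) ^ 2 ≤ L ^ 2 * min 1 (‖x - y‖ ^ 2) := by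
      have hle1 : |χ k x - χ k y| ≤ 1 := by
        rw [abs_le]
        constructor <;> linarith [h0 k x, h1 k x, h0 k y, h1 k y]
      rcases le_total 1 (‖x - y‖ ^ 2) with h | h
      · rw [min_eq_left h, ← sq_abs]
        nlinarith [abs_nonneg (χ k x - χ k y)]
      · rw [min_eq_right h, ← sq_abs, ← mul_pow]
        exact pow_le_pow_left₀ (abs_nonneg _) (hlip k x y) 2
    have hd : (1 - χ k x) ^ 2 ≤ 1 := by nlinarith [h0 k x, h1 k x]
    have hsq : ((u x - χ k x * u x) - (u y - χ k y * u y)) ^ 2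
        ≤ 2 * (u x - u y) ^ 2 + 2 * L ^ 2 * (u y ^ 2 * min 1 (‖x - y‖ ^ 2)) := by
      calc _ = ((1 - χ k x) * (u x - u y) - (χ k x - χ k y) * u y) ^ 2 := by ring
        _ ≤ 2 * ((1 - χ k x) * (u x - u y)) ^ 2 + 2 * ((χ k x - χ k y) * u y) ^ 2 := by
            nlinarith [sq_nonneg ((1 - χ k x) * (u x - u y) + (χ k x - χ k y) * u y)]
        _ = 2 * ((1 - χ k x) ^ 2 * (u x - u y) ^ 2) + 2 * ((χ k x - χ k y) ^ 2 * u y ^ 2) := by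
            ring
        _ ≤ 2 * (1 * (u x - u y) ^ 2) + 2 * ((L ^ 2 * min 1 (‖x - y‖ ^ 2)) * u y ^ 2) := by
            gcongr
        _ = _ := by ring
    calc _ ≤ (2 * (u x - u y) ^ 2 + 2 * L ^ 2 * (u y ^ 2 * min 1 (‖x - y‖ ^ 2))) * k' := by
          gcongr
      _ = _ := by ring
  · obtain ⟨N, hN⟩ := exists_nat_ge (max ‖p.1‖ ‖p.2‖)
    refine tendsto_const_nhds.congr' ?_
    filter_upwards [eventually_ge_atTop N] with k hk
    have hk' : (N : ℝ) ≤ k := by exact_mod_cast hk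
    rw [hone k p.1 ((le_max_left _ _).trans (hN.trans hk')),
      hone k p.2 ((le_max_right _ _).trans (hN.trans hk'))]
    simp

lemma tendsto_eLpNorm_cutoff {q : ℝ} (hq : 0 < q) {u : Rn n → ℝ}
    (hum : Measurable u) (hu : MemLp u (ENNReal.ofReal q) volume)
    {χ : ℕ → Rn n → ℝ} (hχm : ∀ k, Measurable (χ k)) (h0 : ∀ k x, 0 ≤ χ k x)
    (h1 : ∀ k x, χ k x ≤ 1) (hone : ∀ (k : ℕ) x, ‖x‖ ≤ k → χ k x = 1) :
    Tendsto (fun k => eLpNorm (fun x => u x - χ k x * u x) (ENNReal.ofReal q) volume)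
      atTop (𝓝 0) := by
  have hfin := hu.2
  simp only [eLpNorm_ofReal_eq hq] at hfin ⊢
  rw [ENNReal.rpow_lt_top_iff_of_pos (by positivity)] at hfin
  have hlim := tendsto_lintegral_of_dominated_convergence (μ := (volume : Measure (Rn n)))
    (F := fun (k : ℕ) (x : Rn n) => ‖u x - χ k x * u x‖ₑ ^ q) (f := fun _ => 0)
    (fun x => ‖u x‖ₑ ^ q) (fun k => by have := hχm k; fun_prop)
    (fun k => .of_forall fun x => ?_) hfin.ne (.of_forall fun x => ?_)
  · simp only [lintegral_zero] at hlim
    have := ((ENNReal.continuous_rpow_const (y := 1 / q)).tendsto 0).comp hlim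
    rw [ENNReal.zero_rpow_of_pos (by positivity)] at this
    exact this
  · refine ENNReal.rpow_le_rpow ?_ hq.le
    rw [show u x - χ k x * u x = (1 - χ k x) * u x by ring, enorm_mul]
    refine mul_le_of_le_one_left' ?_
    rw [Real.enorm_of_nonneg (by linarith [h1 k x]), ← ENNReal.ofReal_one]
    exact ENNReal.ofReal_le_ofReal (by linarith [h0 k x])
  · obtain ⟨N, hN⟩ := exists_nat_ge ‖x‖
    refine tendsto_const_nhds.congr' ?_
    filter_upwards [eventually_ge_atTop N] with k hk
    have hk' : (N : ℝ) ≤ k := by exact_mod_cast hk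
    rw [hone k x (hN.trans hk')]
    simp [hq]

/-! ### Decay of Riesz potentials and of Schwartz functions -/

lemma abs_le_of_enorm_le {r C : ℝ} (hC : 0 ≤ C) (h : ‖r‖ₑ ≤ ENNReal.ofReal C) : |r| ≤ C := by
  rw [Real.enorm_eq_ofReal_abs] at h
  exact (ENNReal.ofReal_le_ofReal_iff hC).1 h

/-- The potential of a bounded function supported in a ball decays like the kernel, linearly in the
bound; the linearity lets the lemma be applied to differences of translates as well. -/
lemma exists_rieszPot_le_decay [NeZero n] {s : ℝ} (hs : 0 < s) (hn : 2 * s < n) {ρ : ℝ}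
    (hρ : 1 ≤ ρ) :
    ∃ C : ℝ, 0 ≤ C ∧ ∀ (M : ℝ) (ψ : Rn n → ℝ), 0 ≤ M → (∀ y, |ψ y| ≤ M) →
      (∀ y, ρ ≤ ‖y‖ → ψ y = 0) → ∀ x, rieszPot s (fun y => ‖ψ y‖ₑ) x
        ≤ ENNReal.ofReal (C * M * (1 + ‖x‖) ^ (-((n : ℝ) - 2 * s))) := by
  set a := (n : ℝ) - 2 * s with ha
  have ha0 : 0 < a := by rw [ha]; linarith
  set A := ∫⁻ z in Metric.ball (0 : Rn n) (3 * ρ), powKernel a z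
  have hA : A ≠ ⊤ := (setLIntegral_powKernel_ball_lt_top (by linarith) _).ne
  set V := volume (Metric.ball (0 : Rn n) ρ)
  have hV : V ≠ ⊤ := measure_ball_lt_top.ne
  refine ⟨A.toReal * (1 + 2 * ρ) ^ a + 4 ^ a * V.toReal, by positivity,
    fun M ψ hM hψ hsupp x => ?_⟩
  have step : rieszPot s (fun y => ‖ψ y‖ₑ) x
      ≤ ENNReal.ofReal M * ∫⁻ y in Metric.ball (0 : Rn n) ρ, powKernel a (x - y) := by
    rw [rieszPot, ← lintegral_const_mul _ (by fun_prop), ← lintegral_indicator measurableSet_ball]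
    refine lintegral_mono fun y => ?_
    by_cases hy : y ∈ Metric.ball (0 : Rn n) ρ
    · rw [Set.indicator_of_mem hy]
      gcongr
      rw [Real.enorm_eq_ofReal_abs]
      exact ENNReal.ofReal_le_ofReal (hψ y)
    · have hy' : ρ ≤ ‖y‖ := by simpa using hy
      simp [hsupp y hy']
  refine step.trans ?_
  rw [mul_right_comm, mul_comm, ENNReal.ofReal_mul' hM]
  refine mul_le_mul_left ?_ _
  have hx1 : 0 < 1 + ‖x‖ := by positivity
  have hP : 0 ≤ (1 + ‖x‖) ^ (-a) := by positivity
  rcases le_or_gt (2 * ρ) ‖x‖ with hx | hx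
  · calc ∫⁻ y in Metric.ball (0 : Rn n) ρ, powKernel a (x - y)
        ≤ ∫⁻ y in Metric.ball (0 : Rn n) ρ, ENNReal.ofReal (4 ^ a * (1 + ‖x‖) ^ (-a)) := by
          refine setLIntegral_mono' measurableSet_ball fun y hy => ENNReal.ofReal_le_ofReal ?_
          have hy' : ‖y‖ < ρ := by simpa using hy
          have h1 : (1 + ‖x‖) / 4 ≤ ‖x - y‖ := by
            have := norm_sub_norm_le x y
            linarith
          calc ‖x - y‖ ^ (-a) ≤ ((1 + ‖x‖) / 4) ^ (-a) :=
                Real.rpow_le_rpow_of_nonpos (by positivity) h1 (by linarith)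
            _ = 4 ^ a * (1 + ‖x‖) ^ (-a) := by
                rw [Real.div_rpow hx1.le (by norm_num), Real.rpow_neg (by norm_num : (0:ℝ) ≤ 4),
                  div_inv_eq_mul, mul_comm]
      _ = ENNReal.ofReal (4 ^ a * V.toReal * (1 + ‖x‖) ^ (-a)) := by
          rw [setLIntegral_const, ← ENNReal.ofReal_toReal (a := volume _) hV,
            ← ENNReal.ofReal_mul (by positivity)]
          congr 1
          ring
      _ ≤ _ := by
          refine ENNReal.ofReal_le_ofReal ?_
          refine mul_le_mul_of_nonneg_right ?_ hP
          have : 0 ≤ A.toReal * (1 + 2 * ρ) ^ a := by positivity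
          linarith
  · calc ∫⁻ y in Metric.ball (0 : Rn n) ρ, powKernel a (x - y)
        ≤ ∫⁻ y in {y | x - y ∈ Metric.ball (0 : Rn n) (3 * ρ)}, powKernel a (x - y) := by
          refine lintegral_mono_set fun y hy => ?_
          have hy' : ‖y‖ < ρ := by simpa using hy
          change x - y ∈ Metric.ball (0 : Rn n) (3 * ρ)
          rw [mem_ball_zero_iff]
          have := norm_sub_le x y
          linarith
      _ = ENNReal.ofReal A.toReal := by
          rw [setLIntegral_sub_left (powKernel a) x _ measurableSet_ball, ENNReal.ofReal_toReal hA]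
      _ ≤ _ := by
          refine ENNReal.ofReal_le_ofReal ?_
          have h1 : 1 ≤ (1 + 2 * ρ) ^ a * (1 + ‖x‖) ^ (-a) := by
            rw [Real.rpow_neg hx1.le, ← div_eq_mul_inv, one_le_div (by positivity)]
            exact Real.rpow_le_rpow hx1.le (by linarith) ha0.le
          have h2 : 0 ≤ 4 ^ a * V.toReal * (1 + ‖x‖) ^ (-a) := by positivity
          have h3 : 0 ≤ A.toReal := ENNReal.toReal_nonneg
          nlinarith

lemma exists_decay_rieszJ [NeZero n] {s : ℝ} (hs : 0 < s) (hn : 2 * s < n) {ψ : Rn n → ℝ}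
    (hψ : ContDiff ℝ ∞ ψ) (hψc : HasCompactSupport ψ) :
    ∃ C : ℝ, (∀ x, |rieszJ s ψ x| ≤ C * (1 + ‖x‖) ^ (-((n : ℝ) - 2 * s))) ∧
      ∀ x y, ‖x - y‖ ≤ 1 →
        |rieszJ s ψ x - rieszJ s ψ y| ≤ C * ‖x - y‖ * (1 + ‖x‖) ^ (-((n : ℝ) - 2 * s)) := by
  obtain ⟨M, hM0, hM⟩ := exists_bound_of_continuous_hasCompactSupport hψ.continuous hψc
  obtain ⟨K, hK⟩ := ContDiff.lipschitzWith_of_hasCompactSupport (𝕂 := ℝ) hψc hψ (by simp)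
  obtain ⟨R, hR⟩ := hψc.isCompact.isBounded.exists_norm_le
  set ρ := max R 0 + 2 with hρ
  have hsupp : ∀ y, ρ - 1 ≤ ‖y‖ → ψ y = 0 := by
    intro y hy
    refine image_eq_zero_of_notMem_tsupport fun hy' => ?_
    have := hR y hy'
    have := le_max_left R 0
    linarith
  obtain ⟨C, hC, hbound⟩ := exists_rieszPot_le_decay (n := n) hs hn (ρ := ρ)
    (by have := le_max_right R 0; linarith)
  have hψm : AEStronglyMeasurable ψ volume := hψ.continuous.aestronglyMeasurable
  have hpot := hbound M ψ hM0.le hM (fun y hy => hsupp y (by linarith))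
  have hint : ∀ x, Integrable (rieszIntegrand s ψ x) := fun x =>
    integrable_rieszIntegrand hψm ((hpot x).trans_lt ENNReal.ofReal_lt_top)
  refine ⟨max (C * M) (C * K), fun x => ?_, fun x y hxy => ?_⟩
  · have h := abs_le_of_enorm_le (by positivity) ((enorm_rieszJ_le s ψ x).trans (hpot x))
    refine h.trans ?_
    gcongr
    exact le_max_left _ _
  · -- `Jψ(y)` is the potential at `x` of the translate of `ψ` by `y - x`
    set χ : Rn n → ℝ := fun z => ψ (z + (y - x)) with hχ
    have htr : rieszIntegrand s χ x = fun z => rieszIntegrand s ψ y (z + (y - x)) := by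
      ext z
      simp only [rieszIntegrand, hχ]
      congr 3
      abel
    have hχi : Integrable (rieszIntegrand s χ x) := by
      rw [htr]
      exact (hint y).comp_add_right (y - x)
    have hJ : rieszJ s ψ y = rieszJ s χ x := by
      rw [rieszJ, rieszJ, htr, integral_add_right_eq_self (rieszIntegrand s ψ y) (y - x)]
    rw [hJ, ← rieszJ_sub (hint x) hχi]
    have h := hbound (K * ‖x - y‖) (fun z => ψ z - χ z) (by positivity) (fun z => by
        have h1 := hK.dist_le_mul z (z + (y - x))
        rw [Real.dist_eq, dist_eq_norm, sub_add_cancel_left, neg_sub] at h1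
        exact h1)
      (fun z hz => by
        have h1 : ‖z‖ ≤ ‖z + (y - x)‖ + ‖x - y‖ := by
          have := norm_sub_le (z + (y - x)) (y - x)
          rwa [add_sub_cancel_right, norm_sub_rev y x] at this
        simp only [hχ]
        rw [hsupp z (by linarith), hsupp (z + (y - x)) (by linarith), sub_zero]) x
    have h' := abs_le_of_enorm_le (by positivity) ((enorm_rieszJ_le s _ x).trans h)
    refine h'.trans ?_
    rw [← mul_assoc]
    gcongr
    exact le_max_right _ _

lemma locallyIntegrable_norm_rpow [NeZero n] {a : ℝ} (ha : a < n) :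
    LocallyIntegrable (fun z : Rn n => ‖z‖ ^ (-a)) volume := fun x =>
  ⟨Metric.ball 0 (‖x‖ + 1), Metric.isOpen_ball.mem_nhds (by simp),
    integrableOn_ball_norm_rpow ha _⟩

lemma contDiff_rieszJ [NeZero n] {s : ℝ} (hs : 0 < s) {ψ : Rn n → ℝ}
    (hψ : ContDiff ℝ ∞ ψ) (hψc : HasCompactSupport ψ) : ContDiff ℝ ∞ (rieszJ s ψ) := by
  have h : rieszJ s ψ = (fun z : Rn n => ‖z‖ ^ (-((n : ℝ) - 2 * s)))
      ⋆[ContinuousLinearMap.mul ℝ ℝ, volume] ψ := by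
    ext x
    rw [rieszJ, convolution_def, ← integral_sub_left_eq_self _ _ x]
    refine integral_congr_ae (.of_forall fun y => ?_)
    simp only [ContinuousLinearMap.mul_apply', rieszIntegrand]
    rw [sub_sub_cancel, Real.rpow_neg (norm_nonneg _), div_eq_inv_mul]
  rw [h]
  exact hψc.contDiff_convolution_right _ (locallyIntegrable_norm_rpow (by linarith)) hψ

lemma exists_decay_schwartz (f : SchwartzMap (Rn n) ℝ) :
    ∃ C : ℝ, (∀ x, |f x| ≤ C * (1 + ‖x‖) ^ (-(n : ℝ))) ∧
      ∀ x y, ‖x - y‖ ≤ 1 → |f x - f y| ≤ C * ‖x - y‖ * (1 + ‖x‖) ^ (-(n : ℝ)) := by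
  set B : ℝ := 2 ^ n * ((Finset.Iic (n, 1)).sup fun m => SchwartzMap.seminorm ℝ m.1 m.2) f with hB
  have hB0 : 0 ≤ B := by positivity
  have hb : ∀ m ≤ 1, ∀ x, ‖iteratedFDeriv ℝ m f x‖ ≤ B * (1 + ‖x‖) ^ (-(n : ℝ)) := by
    intro m hm x
    have h := SchwartzMap.one_add_le_sup_seminorm_apply (𝕜 := ℝ) (m := (n, 1)) (k := n) (n := m)
      le_rfl hm f x
    rw [Real.rpow_neg (by positivity), Real.rpow_natCast, ← div_eq_mul_inv,
      le_div_iff₀ (by positivity), mul_comm]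
    exact h
  have h2 : (1 : ℝ) ≤ 2 ^ n := one_le_pow₀ one_le_two
  refine ⟨2 ^ n * B, fun x => ?_, fun x y hxy => ?_⟩
  · have h := hb 0 zero_le_one x
    rw [norm_iteratedFDeriv_zero, Real.norm_eq_abs] at h
    refine h.trans ?_
    gcongr
    exact le_mul_of_one_le_left hB0 h2
  · have hd : ∀ z ∈ segment ℝ x y, ‖fderiv ℝ f z‖ ≤ 2 ^ n * B * (1 + ‖x‖) ^ (-(n : ℝ)) := by
      intro z hz
      have h := hb 1 le_rfl z
      rw [norm_iteratedFDeriv_one] at h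
      have hzx : ‖x - z‖ ≤ 1 := by
        have := norm_sub_le_of_mem_segment hz
        rw [norm_sub_rev] at hxy
        rw [norm_sub_rev]
        linarith
      have h3 : (1 + ‖x‖) / 2 ≤ 1 + ‖z‖ := by
        have h4 := norm_sub_norm_le x z
        have h5 := norm_nonneg z
        linarith
      refine h.trans ?_
      calc B * (1 + ‖z‖) ^ (-(n : ℝ)) ≤ B * ((1 + ‖x‖) / 2) ^ (-(n : ℝ)) := by
            gcongr B * ?_
            exact Real.rpow_le_rpow_of_nonpos (by positivity) h3 (by simp)
        _ = _ := by
            rw [Real.div_rpow (by positivity) (by norm_num), Real.rpow_neg (by norm_num : (0:ℝ) ≤ 2),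
              div_inv_eq_mul, Real.rpow_natCast]
            ring
    have h := (convex_segment x y).norm_image_sub_le_of_norm_fderiv_le
      (fun z _ => f.differentiableAt) hd (right_mem_segment ℝ x y) (left_mem_segment ℝ x y)
    rw [Real.norm_eq_abs] at h
    refine h.trans (le_of_eq ?_)
    ring

/-! ### Approximation by test functions in the homogeneous space -/

/-- `u` is a limit of smooth compactly supported functions for the norm
`gagliardo + ‖·‖_{L^{2n/(n-2s)}}`. -/
def HdotApprox (s : ℝ) (u : Rn n → ℝ) : Prop :=
  ∀ ε : ℝ≥0∞, ε ≠ 0 → ∃ f : Rn n → ℝ, ContDiff ℝ ∞ f ∧ HasCompactSupport f ∧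
    gagliardo s (fun x => u x - f x) + eLpNorm (fun x => u x - f x) (critExp n s) volume ≤ ε

lemma hdotApprox_of_contDiff [NeZero n] {s : ℝ} (hs0 : 0 < s) (hs1 : s < 1) (hn : 2 * s < n)
    {u : Rn n → ℝ} (hu : ContDiff ℝ ∞ u) (hu2 : MemLp u 2 volume)
    (huq : MemLp u (critExp n s) volume) (hug : gagliardo s u < ⊤) : HdotApprox s u := by
  obtain ⟨L, hL, χ, hχ, hχc, h0, h1, hone, hlip⟩ := exists_cutoff n
  have hum := hu.continuous.measurable
  have hχm := fun k => (hχ k).continuous.measurable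
  have t1 := tendsto_gagliardo_cutoff hs0 hs1 hum hu2 hug hL hχm h0 h1 hone hlip
  have t2 := tendsto_eLpNorm_cutoff (qExp_pos hs0 hn) hum huq hχm h0 h1 hone
  have t := t1.add t2
  rw [add_zero] at t
  intro ε hε
  obtain ⟨k, hk⟩ := (t.eventually_le_const (pos_iff_ne_zero.2 hε)).exists
  exact ⟨fun x => χ k x * u x, (hχ k).mul hu, (hχc k).mul_right, hk⟩

lemma memLp_schwartz (f : SchwartzMap (Rn n) ℝ) (p : ℝ≥0∞) : MemLp f p volume :=
  f.memLp p volume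

lemma gagliardo_schwartz_lt_top [NeZero n] {s : ℝ} (hs0 : 0 < s) (hs1 : s < 1)
    (f : SchwartzMap (Rn n) ℝ) : gagliardo s f < ⊤ := by
  obtain ⟨C, h1, h2⟩ := exists_decay_schwartz f
  have hn : (0 : ℝ) < n := by exact_mod_cast Nat.pos_of_neZero n
  exact gagliardo_lt_top_of_decay hs0 hs1 (r := n) (by linarith) h1 h2

lemma hdotApprox_schwartz [NeZero n] {s : ℝ} (hs0 : 0 < s) (hs1 : s < 1) (hn : 2 * s < n)
    (f : SchwartzMap (Rn n) ℝ) : HdotApprox s f :=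
  hdotApprox_of_contDiff hs0 hs1 hn (f.smooth ⊤) (memLp_schwartz f _) (memLp_schwartz f _)
    (gagliardo_schwartz_lt_top hs0 hs1 f)

lemma gagliardo_sub_add_eLpNorm_le {s : ℝ} (hs : 0 < s) (hn : 2 * s < n) {u v w : Rn n → ℝ}
    (hu : AEStronglyMeasurable u volume) (hv : AEStronglyMeasurable v volume)
    (hw : AEStronglyMeasurable w volume) :
    gagliardo s (fun x => u x - w x) + eLpNorm (fun x => u x - w x) (critExp n s) volume
      ≤ (gagliardo s (fun x => u x - v x) + eLpNorm (fun x => u x - v x) (critExp n s) volume)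
        + (gagliardo s (fun x => v x - w x)
          + eLpNorm (fun x => v x - w x) (critExp n s) volume) := by
  have e : (fun x => u x - w x) = fun x => (u x - v x) + (v x - w x) := by
    ext x
    ring
  rw [e, add_add_add_comm]
  exact add_le_add (gagliardo_add_le s (hu.sub hv) (hv.sub hw))
    (eLpNorm_add_le (hu.sub hv) (hv.sub hw) (one_le_critExp hs hn))

lemma HdotApprox.of_closure {s : ℝ} (hs : 0 < s) (hn : 2 * s < n) {u : Rn n → ℝ}
    (hu : AEStronglyMeasurable u volume)
    (h : ∀ ε : ℝ≥0∞, ε ≠ 0 → ∃ v : Rn n → ℝ, AEStronglyMeasurable v volume ∧ HdotApprox s v ∧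
      gagliardo s (fun x => u x - v x) + eLpNorm (fun x => u x - v x) (critExp n s) volume ≤ ε) :
    HdotApprox s u := by
  intro ε hε
  obtain ⟨v, hvm, hv, huv⟩ := h (ε / 2) (by simpa using hε)
  obtain ⟨f, hf, hfc, hvf⟩ := hv (ε / 2) (by simpa using hε)
  refine ⟨f, hf, hfc, (gagliardo_sub_add_eLpNorm_le hs hn hu hvm
    hf.continuous.aestronglyMeasurable).trans ?_⟩
  exact (add_le_add huv hvf).trans (ENNReal.add_halves ε).le

lemma hdotApprox_of_memHdot [NeZero n] {s : ℝ} (hs0 : 0 < s) (hs1 : s < 1) (hn : 2 * s < n)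
    {u : Rn n → ℝ} (hu : MemHdot s u) : HdotApprox s u := by
  obtain ⟨hum, f, hf⟩ := hu
  refine HdotApprox.of_closure hs0 hn hum.1 fun ε hε => ?_
  obtain ⟨k, hk⟩ := (hf.eventually_le_const (pos_iff_ne_zero.2 hε)).exists
  exact ⟨f k, (f k).continuous.aestronglyMeasurable, hdotApprox_schwartz hs0 hs1 hn (f k), hk⟩

lemma memHdot_of_hdotApprox {s : ℝ} {u : Rn n → ℝ} (hu : MemLp u (critExp n s) volume)
    (h : HdotApprox s u) : MemHdot s u := by
  choose f hf hfc hle using fun k : ℕ => h ((k : ℝ≥0∞)⁻¹) (by simp)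
  exact ⟨hu, fun k => (hfc k).toSchwartzMap (hf k),
    tendsto_of_tendsto_of_tendsto_of_le_of_le tendsto_const_nhds ENNReal.tendsto_inv_nat_nhds_zero
      (fun _ => zero_le) hle⟩

lemma gagliardo_test_lt_top [NeZero n] {s : ℝ} (hs0 : 0 < s) (hs1 : s < 1) {f : Rn n → ℝ}
    (hf : ContDiff ℝ ∞ f) (hfc : HasCompactSupport f) : gagliardo s f < ⊤ :=
  gagliardo_schwartz_lt_top hs0 hs1 (hfc.toSchwartzMap hf)

lemma HdotApprox.gagliardo_lt_top [NeZero n] {s : ℝ} (hs0 : 0 < s) (hs1 : s < 1) {u : Rn n → ℝ}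
    (hum : AEStronglyMeasurable u volume) (hu : HdotApprox s u) : gagliardo s u < ⊤ := by
  obtain ⟨f, hf, hfc, hle⟩ := hu 1 one_ne_zero
  have h := gagliardo_add_le s (hum.sub hf.continuous.aestronglyMeasurable)
    (hf.continuous.aestronglyMeasurable (μ := volume))
  simp only [Pi.sub_apply, sub_add_cancel] at h
  refine h.trans_lt (ENNReal.add_lt_top.2 ⟨?_, gagliardo_test_lt_top hs0 hs1 hf hfc⟩)
  exact (le_self_add.trans hle).trans_lt ENNReal.one_lt_top

/-- The decay exponent `n - 2s` of `Jψ` is square integrable at infinity because `4s < n`. -/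
lemma rieszJ_test [NeZero n] {s : ℝ} (hs0 : 0 < s) (hs1 : s < 1) (hn : 4 * s < n) {ψ : Rn n → ℝ}
    (hψ : ContDiff ℝ ∞ ψ) (hψc : HasCompactSupport ψ) (hq : MemLp (rieszJ s ψ) (critExp n s) volume) :
    gagliardo s (rieszJ s ψ) < ⊤ ∧ HdotApprox s (rieszJ s ψ) := by
  obtain ⟨C, h1, h2⟩ := exists_decay_rieszJ hs0 (by linarith) hψ hψc
  have hg := gagliardo_lt_top_of_decay hs0 hs1 (by linarith) h1 h2
  exact ⟨hg, hdotApprox_of_contDiff hs0 hs1 (by linarith) (contDiff_rieszJ hs0 hψ hψc)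
    (memLp_two_of_decay (by linarith) (contDiff_rieszJ hs0 hψ hψc).continuous.aestronglyMeasurable
      h1) hq hg⟩

/-! ### The energy estimate and the passage to `L^β` -/

lemma lintegral_enorm_mul_le {s : ℝ} (hs : 0 < s) (hn : 2 * s < n) {ψ φ : Rn n → ℝ}
    (hψ : AEStronglyMeasurable ψ volume) (hφ : AEStronglyMeasurable φ volume) :
    ∫⁻ x, ‖ψ x * φ x‖ₑ ≤ eLpNorm ψ (betaExp n s) volume * eLpNorm φ (critExp n s) volume := by
  rw [betaExp, ← bExp, critExp, ← qExp, eLpNorm_ofReal_eq (bExp_pos hs hn),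
    eLpNorm_ofReal_eq (qExp_pos hs hn)]
  simp only [enorm_mul]
  exact ENNReal.lintegral_mul_le_Lp_mul_Lq _ (holderConjugate_bExp_qExp hs hn)
    hψ.aemeasurable.enorm hφ.aemeasurable.enorm

lemma integrable_mul_of_memLp {s : ℝ} (hs : 0 < s) (hn : 2 * s < n) {ψ φ : Rn n → ℝ}
    (hψ : MemLp ψ (betaExp n s) volume) (hφ : MemLp φ (critExp n s) volume) :
    Integrable fun x => ψ x * φ x :=
  ⟨hψ.1.mul hφ.1, hasFiniteIntegral_iff_enorm.2
    ((lintegral_enorm_mul_le hs hn hψ.1 hφ.1).trans_lt (ENNReal.mul_lt_top hψ.2 hφ.2))⟩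

lemma enorm_integral_mul_le {s : ℝ} (hs : 0 < s) (hn : 2 * s < n) {ψ φ : Rn n → ℝ}
    (hψ : AEStronglyMeasurable ψ volume) (hφ : AEStronglyMeasurable φ volume) :
    ‖∫ x, ψ x * φ x‖ₑ ≤ eLpNorm ψ (betaExp n s) volume * eLpNorm φ (critExp n s) volume :=
  (enorm_integral_le_lintegral_enorm _).trans (lintegral_enorm_mul_le hs hn hψ hφ)

lemma eq_zero_of_forall_le_mul {x K : ℝ≥0∞} (hK : K ≠ ⊤) (h : ∀ ε : ℝ≥0∞, ε ≠ 0 → x ≤ K * ε) :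
    x = 0 := by
  have t : Tendsto (fun k : ℕ => K * (k : ℝ≥0∞)⁻¹) atTop (𝓝 (K * 0)) :=
    ENNReal.Tendsto.const_mul ENNReal.tendsto_inv_nat_nhds_zero (.inr hK)
  rw [mul_zero] at t
  exact le_antisymm (ge_of_tendsto' t fun k => h _ (by simp)) zero_le

lemma integral_formIntegrand_sub_right {s : ℝ} {u φ f : Rn n → ℝ}
    (h1 : Integrable (formIntegrand s u φ) (volume.prod volume))
    (h2 : Integrable (formIntegrand s u f) (volume.prod volume)) :
    ∫ p, formIntegrand s u (fun x => φ x - f x) p ∂(volume.prod volume)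
      = ∫ p, formIntegrand s u φ p ∂(volume.prod volume)
        - ∫ p, formIntegrand s u f p ∂(volume.prod volume) := by
  rw [← integral_sub h1 h2]
  refine integral_congr_ae (.of_forall fun p => ?_)
  simp only [formIntegrand]
  ring

lemma formIntegrand_comm (s : ℝ) (u φ : Rn n → ℝ) : formIntegrand s u φ = formIntegrand s φ u := by
  ext p
  simp only [formIntegrand]
  ring

/-- The weak equation extends from test functions to their closure, by continuity of both sides. -/
lemma integral_formIntegrand_eq_of_hdotApprox [NeZero n] {s : ℝ} (hs0 : 0 < s) (hs1 : s < 1)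
    (hn : 2 * s < n) {u ψ φ : Rn n → ℝ} {c : ℝ} (hu : AEStronglyMeasurable u volume)
    (hug : gagliardo s u < ⊤) (hψ : MemLp ψ (betaExp n s) volume)
    (htest : ∀ f : Rn n → ℝ, ContDiff ℝ ∞ f → HasCompactSupport f →
      ∫ p, formIntegrand s u f p ∂(volume.prod volume) = c * ∫ x, ψ x * f x)
    (hφ : MemLp φ (critExp n s) volume) (hφa : HdotApprox s φ) :
    ∫ p, formIntegrand s u φ p ∂(volume.prod volume) = c * ∫ x, ψ x * φ x := by
  have hφg := hφa.gagliardo_lt_top hs0 hs1 hφ.1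
  rw [← sub_eq_zero, ← enorm_eq_zero]
  have hK : gagliardo s u + ‖c‖ₑ * eLpNorm ψ (betaExp n s) volume ≠ ⊤ := by
    have := hψ.2.ne
    have := hug.ne
    finiteness
  refine eq_zero_of_forall_le_mul hK fun ε hε => ?_
  obtain ⟨f, hf, hfc, hle⟩ := hφa ε hε
  have hfm : AEStronglyMeasurable f volume := hf.continuous.aestronglyMeasurable
  have hfg := gagliardo_test_lt_top hs0 hs1 hf hfc
  have hfq : MemLp f (critExp n s) volume := hf.continuous.memLp_of_hasCompactSupport hfc
  have e1 := integral_formIntegrand_sub_right (integrable_formIntegrand hu hφ.1 hug hφg)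
    (integrable_formIntegrand hu hfm hug hfg)
  have e2 : ∫ x, ψ x * (φ x - f x) = (∫ x, ψ x * φ x) - ∫ x, ψ x * f x := by
    rw [← integral_sub (integrable_mul_of_memLp hs0 hn hψ hφ)
      (integrable_mul_of_memLp hs0 hn hψ hfq)]
    simp only [mul_sub]
  have e : ∫ p, formIntegrand s u φ p ∂(volume.prod volume) - c * ∫ x, ψ x * φ x
      = ∫ p, formIntegrand s u (fun x => φ x - f x) p ∂(volume.prod volume)
        - c * ∫ x, ψ x * (φ x - f x) := by
    rw [e1, e2, htest f hf hfc]
    ring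
  rw [e, add_mul]
  refine (enorm_sub_le).trans (add_le_add ?_ ?_)
  · refine (enorm_integral_formIntegrand_le hu (hφ.1.sub hfm)).trans ?_
    gcongr
    exact le_self_add.trans hle
  · rw [enorm_mul, mul_assoc]
    gcongr
    refine (enorm_integral_mul_le hs0 hn hψ.1 (hφ.1.sub hfm)).trans ?_
    gcongr
    exact le_add_self.trans hle

lemma gagliardo_rpow_two {s : ℝ} {u : Rn n → ℝ} (hu : AEStronglyMeasurable u volume)
    (hug : gagliardo s u < ⊤) :
    gagliardo s u ^ (2 : ℝ)
      = ENNReal.ofReal (∫ p, formIntegrand s u u p ∂(volume.prod volume)) := by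
  have hsq : ∀ p, formIntegrand s u u p
      = |u p.1 - u p.2| ^ 2 / ‖p.1 - p.2‖ ^ ((n : ℝ) + 2 * s) := by
    intro p
    rw [formIntegrand, ← sq, sq_abs]
  rw [gagliardo, ← ENNReal.rpow_mul, one_div_mul_cancel two_ne_zero, ENNReal.rpow_one,
    ofReal_integral_eq_lintegral_ofReal (integrable_formIntegrand hu hu hug hug)]
  · simp_rw [hsq]
  · refine .of_forall fun p => ?_
    rw [hsq]
    positivity

lemma exists_test_eLpNorm_sub_le {s : ℝ} (hs : 0 < s) (hn : 2 * s < n) {ψ : Rn n → ℝ}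
    (hψ : MemLp ψ (betaExp n s) volume) {ε : ℝ≥0∞} (hε : ε ≠ 0) :
    ∃ f : Rn n → ℝ, ContDiff ℝ ∞ f ∧ HasCompactSupport f ∧ MemLp f (betaExp n s) volume ∧
      eLpNorm (fun x => ψ x - f x) (betaExp n s) volume ≤ ε := by
  have hm : min ε 1 ≠ ⊤ := ne_top_of_le_ne_top ENNReal.one_ne_top (min_le_right _ _)
  have hm0 : min ε 1 ≠ 0 := by simp [hε]
  obtain ⟨f, hfc, hf, hle⟩ := hψ.exist_eLpNorm_sub_le ENNReal.ofReal_ne_top (one_le_betaExp hs hn)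
    (ENNReal.toReal_pos hm0 hm)
  rw [ENNReal.ofReal_toReal hm] at hle
  exact ⟨f, hf, hfc, hf.continuous.memLp_of_hasCompactSupport hfc, hle.trans (min_le_left _ _)⟩

lemma rieszJ_sub_ae [NeZero n] {s : ℝ} (hs : 0 < s) (hn : 2 * s < n) {ψ χ : Rn n → ℝ}
    (hψ : MemLp ψ (betaExp n s) volume) (hχ : MemLp χ (betaExp n s) volume) :
    rieszJ s (fun y => ψ y - χ y) =ᵐ[volume] fun x => rieszJ s ψ x - rieszJ s χ x := by
  filter_upwards [ae_integrable_rieszIntegrand hs hn hψ, ae_integrable_rieszIntegrand hs hn hχ]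
    with x h1 h2
  exact rieszJ_sub h1 h2

/-- For a test function `ψ` the energy of `Jψ` is `c ∫ ψ Jψ`, which Hölder and the
Hardy–Littlewood–Sobolev inequality bound; Fatou's lemma extends the bound to `L^β`. -/
lemma exists_gagliardo_rieszJ_le [NeZero n] {s c : ℝ} (hs0 : 0 < s) (hs1 : s < 1)
    (hn : 4 * s < n) (hc : 0 < c)
    (hcore : ∀ ψ φ : Rn n → ℝ, ContDiff ℝ ∞ ψ → HasCompactSupport ψ →
      ContDiff ℝ ∞ φ → HasCompactSupport φ →
      Integrable (formIntegrand s (rieszJ s ψ) φ) (volume.prod volume) →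
      ∫ p, formIntegrand s (rieszJ s ψ) φ p ∂(volume.prod volume) = c * ∫ x, ψ x * φ x) :
    ∃ C : ℝ, 0 < C ∧ ∀ ψ : Rn n → ℝ, MemLp ψ (betaExp n s) volume →
      gagliardo s (rieszJ s ψ) ≤ ENNReal.ofReal C * eLpNorm ψ (betaExp n s) volume := by
  have hn2 : 2 * s < n := by linarith
  obtain ⟨C₀, hC₀, hHLS⟩ := exists_eLpNorm_rieszJ_le (n := n) hs0 hn2
  set C := (c * C₀) ^ (1 / 2 : ℝ) with hC
  have hC0 : 0 < C := by positivity
  have htest : ∀ ψ : Rn n → ℝ, ContDiff ℝ ∞ ψ → HasCompactSupport ψ →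
      gagliardo s (rieszJ s ψ) ≤ ENNReal.ofReal C * eLpNorm ψ (betaExp n s) volume := by
    intro ψ hψ hψc
    have hψβ : MemLp ψ (betaExp n s) volume := hψ.continuous.memLp_of_hasCompactSupport hψc
    obtain ⟨hJ, hJle⟩ := hHLS ψ hψβ
    obtain ⟨hg, ha⟩ := rieszJ_test hs0 hs1 hn hψ hψc hJ
    have hE := integral_formIntegrand_eq_of_hdotApprox hs0 hs1 hn2 hJ.1 hg hψβ
      (fun f hf hfc => hcore ψ f hψ hψc hf hfc (integrable_formIntegrand hJ.1
        hf.continuous.aestronglyMeasurable hg (gagliardo_test_lt_top hs0 hs1 hf hfc))) hJ ha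
    set N := eLpNorm ψ (betaExp n s) volume
    have h2 : gagliardo s (rieszJ s ψ) ^ (2 : ℝ) ≤ (ENNReal.ofReal C * N) ^ (2 : ℝ) := by
      rw [gagliardo_rpow_two hJ.1 hg, hE, ENNReal.ofReal_mul hc.le]
      calc _ ≤ ENNReal.ofReal c * (N * (ENNReal.ofReal C₀ * N)) := by
            gcongr
            refine (Real.ofReal_le_enorm _).trans ?_
            refine (enorm_integral_mul_le hs0 hn2 hψβ.1 hJ.1).trans ?_
            gcongr
        _ = _ := by
            rw [ENNReal.mul_rpow_of_nonneg _ _ zero_le_two,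
              ENNReal.ofReal_rpow_of_pos hC0, hC, ← Real.rpow_mul (by positivity),
              one_div_mul_cancel two_ne_zero, Real.rpow_one, ENNReal.ofReal_mul hc.le,
              ENNReal.rpow_two]
            ring
    exact (ENNReal.rpow_le_rpow_iff two_pos).1 h2
  refine ⟨C, hC0, fun ψ hψ => ?_⟩
  choose f hf hfc hfβ hle using fun k : ℕ =>
    exists_test_eLpNorm_sub_le hs0 hn2 hψ (ε := (k : ℝ≥0∞)⁻¹) (by simp)
  obtain ⟨hJ, -⟩ := hHLS ψ hψ
  have hJf := fun k => (hHLS (f k) (hfβ k)).1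
  -- a subsequence of `J (f k)` converges to `J ψ` almost everywhere
  have hconv : Tendsto (fun k => eLpNorm (rieszJ s (f k) - rieszJ s ψ) (critExp n s) volume)
      atTop (𝓝 0) := by
    have t : Tendsto (fun k : ℕ => ENNReal.ofReal C₀ * (k : ℝ≥0∞)⁻¹) atTop
        (𝓝 (ENNReal.ofReal C₀ * 0)) :=
      ENNReal.Tendsto.const_mul ENNReal.tendsto_inv_nat_nhds_zero (.inr ENNReal.ofReal_ne_top)
    rw [mul_zero] at t
    refine tendsto_of_tendsto_of_tendsto_of_le_of_le tendsto_const_nhds t (fun _ => zero_le)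
      fun k => ?_
    dsimp only
    rw [eLpNorm_sub_comm]
    refine (eLpNorm_congr_ae (rieszJ_sub_ae hs0 hn2 hψ (hfβ k))).symm.le.trans ?_
    refine (hHLS _ (hψ.sub (hfβ k))).2.trans ?_
    gcongr
    exact hle k
  have hcrit0 : critExp n s ≠ 0 :=
    (zero_lt_one.trans_le (one_le_critExp hs0 hn2)).ne'
  obtain ⟨ns, hns, hae⟩ := (tendstoInMeasure_of_tendsto_eLpNorm hcrit0 (fun k => (hJf k).1) hJ.1
    hconv).exists_seq_tendsto_ae
  have hae2 : ∀ᵐ p : Rn n × Rn n ∂(volume.prod volume),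
      Tendsto (fun k => gagQuot s (rieszJ s (f (ns k))) p) atTop (𝓝 (gagQuot s (rieszJ s ψ) p)) := by
    have h1 : ∀ᵐ p : Rn n × Rn n ∂(volume.prod volume),
        Tendsto (fun k => rieszJ s (f (ns k)) p.1) atTop (𝓝 (rieszJ s ψ p.1)) :=
      Measure.quasiMeasurePreserving_fst.ae hae
    have h2 : ∀ᵐ p : Rn n × Rn n ∂(volume.prod volume),
        Tendsto (fun k => rieszJ s (f (ns k)) p.2) atTop (𝓝 (rieszJ s ψ p.2)) :=
      Measure.quasiMeasurePreserving_snd.ae hae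
    filter_upwards [h1, h2] with p hp1 hp2
    exact (hp1.sub hp2).div_const _
  have hfatou := Lp.eLpNorm_lim_le_liminf_eLpNorm (p := 2)
    (fun k => aestronglyMeasurable_gagQuot s (hJf (ns k)).1) _ hae2
  rw [gagliardo_eq_eLpNorm]
  refine hfatou.trans ?_
  have hbd : ∀ k, eLpNorm (gagQuot s (rieszJ s (f (ns k)))) 2 (volume.prod volume)
      ≤ ENNReal.ofReal C * (eLpNorm ψ (betaExp n s) volume + ((ns k : ℕ) : ℝ≥0∞)⁻¹) := by
    intro k
    rw [← gagliardo_eq_eLpNorm]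
    refine (htest _ (hf _) (hfc _)).trans ?_
    gcongr
    have e : f (ns k) = ψ - (fun x => ψ x - f (ns k) x) := by
      ext x
      simp
    calc eLpNorm (f (ns k)) (betaExp n s) volume
        = eLpNorm (ψ - fun x => ψ x - f (ns k) x) (betaExp n s) volume := by rw [← e]
      _ ≤ _ := eLpNorm_sub_le hψ.1 (hψ.1.sub (hfβ _).1) (one_le_betaExp hs0 hn2)
      _ ≤ _ := by gcongr; exact hle _
  have t : Tendsto (fun k : ℕ => ENNReal.ofReal C * (eLpNorm ψ (betaExp n s) volume
      + ((ns k : ℕ) : ℝ≥0∞)⁻¹)) atTop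
      (𝓝 (ENNReal.ofReal C * (eLpNorm ψ (betaExp n s) volume + 0))) :=
    ENNReal.Tendsto.const_mul (tendsto_const_nhds.add
      (ENNReal.tendsto_inv_nat_nhds_zero.comp hns.tendsto_atTop)) (.inr ENNReal.ofReal_ne_top)
  rw [add_zero] at t
  rw [← t.liminf_eq]
  exact liminf_le_liminf (.of_forall hbd)

lemma hdotApprox_rieszJ [NeZero n] {s C : ℝ} (hs0 : 0 < s) (hs1 : s < 1) (hn : 4 * s < n)
    (hC : ∀ ψ : Rn n → ℝ, MemLp ψ (betaExp n s) volume →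
      gagliardo s (rieszJ s ψ) ≤ ENNReal.ofReal C * eLpNorm ψ (betaExp n s) volume)
    {ψ : Rn n → ℝ} (hψ : MemLp ψ (betaExp n s) volume) : HdotApprox s (rieszJ s ψ) := by
  have hn2 : 2 * s < n := by linarith
  obtain ⟨C₀, hC₀, hHLS⟩ := exists_eLpNorm_rieszJ_le (n := n) hs0 hn2
  refine HdotApprox.of_closure hs0 hn2 (hHLS ψ hψ).1.1 fun ε hε => ?_
  set K := ENNReal.ofReal C + ENNReal.ofReal C₀ with hK
  have hKt : K ≠ ⊤ := by finiteness
  have hK0 : K ≠ 0 := by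
    rw [hK]
    simp [hC₀]
  obtain ⟨f, hf, hfc, hfβ, hle⟩ := exists_test_eLpNorm_sub_le hs0 hn2 hψ (ε := ε / K)
    (ENNReal.div_ne_zero.2 ⟨hε, hKt⟩)
  have hJf := (hHLS f hfβ).1
  refine ⟨rieszJ s f, hJf.1, (rieszJ_test hs0 hs1 hn hf hfc hJf).2, ?_⟩
  have hae := rieszJ_sub_ae hs0 hn2 hψ hfβ
  rw [← gagliardo_congr_ae s hae, ← eLpNorm_congr_ae hae]
  have hd : MemLp (fun x => ψ x - f x) (betaExp n s) volume := hψ.sub hfβ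
  calc _ ≤ ENNReal.ofReal C * (ε / K) + ENNReal.ofReal C₀ * (ε / K) :=
        add_le_add ((hC _ hd).trans (by gcongr)) ((hHLS _ hd).2.trans (by gcongr))
    _ = ε := by rw [← add_mul, ← hK, ENNReal.mul_div_cancel hK0 hKt]

/-- The weak equation for `ψ ∈ L^β`, by density of the test functions. -/
lemma integral_formIntegrand_rieszJ [NeZero n] {s c C : ℝ} (hs0 : 0 < s) (hs1 : s < 1)
    (hn : 4 * s < n)
    (hcore : ∀ ψ φ : Rn n → ℝ, ContDiff ℝ ∞ ψ → HasCompactSupport ψ →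
      ContDiff ℝ ∞ φ → HasCompactSupport φ →
      Integrable (formIntegrand s (rieszJ s ψ) φ) (volume.prod volume) →
      ∫ p, formIntegrand s (rieszJ s ψ) φ p ∂(volume.prod volume) = c * ∫ x, ψ x * φ x)
    (hC : ∀ ψ : Rn n → ℝ, MemLp ψ (betaExp n s) volume →
      gagliardo s (rieszJ s ψ) ≤ ENNReal.ofReal C * eLpNorm ψ (betaExp n s) volume)
    {ψ φ : Rn n → ℝ} (hψ : MemLp ψ (betaExp n s) volume)
    (hφ : MemLp φ (critExp n s) volume) (hφa : HdotApprox s φ) :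
    ∫ p, formIntegrand s (rieszJ s ψ) φ p ∂(volume.prod volume) = c * ∫ x, ψ x * φ x := by
  have hn2 : 2 * s < n := by linarith
  obtain ⟨C₀, hC₀, hHLS⟩ := exists_eLpNorm_rieszJ_le (n := n) hs0 hn2
  have hφg := hφa.gagliardo_lt_top hs0 hs1 hφ.1
  have hJg : ∀ ψ : Rn n → ℝ, MemLp ψ (betaExp n s) volume → gagliardo s (rieszJ s ψ) < ⊤ :=
    fun ψ hψ => (hC ψ hψ).trans_lt (ENNReal.mul_lt_top ENNReal.ofReal_lt_top hψ.2)
  have hint : ∀ ψ : Rn n → ℝ, MemLp ψ (betaExp n s) volume →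
      Integrable (formIntegrand s (rieszJ s ψ) φ) (volume.prod volume) := fun ψ hψ =>
    integrable_formIntegrand (hHLS ψ hψ).1.1 hφ.1 (hJg ψ hψ) hφg
  rw [← sub_eq_zero, ← enorm_eq_zero]
  have hK : ENNReal.ofReal C * gagliardo s φ + ‖c‖ₑ * eLpNorm φ (critExp n s) volume ≠ ⊤ := by
    have := hφ.2.ne
    have := hφg.ne
    finiteness
  refine eq_zero_of_forall_le_mul hK fun ε hε => ?_
  obtain ⟨f, hf, hfc, hfβ, hle⟩ := exists_test_eLpNorm_sub_le hs0 hn2 hψ hε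
  have hJf := (hHLS f hfβ).1
  have hd : MemLp (fun x => ψ x - f x) (betaExp n s) volume := hψ.sub hfβ
  have hf_eq := integral_formIntegrand_eq_of_hdotApprox hs0 hs1 hn2 hJf.1 (hJg f hfβ) hfβ
    (fun g hg hgc => hcore f g hf hfc hg hgc (integrable_formIntegrand hJf.1
      hg.continuous.aestronglyMeasurable (hJg f hfβ) (gagliardo_test_lt_top hs0 hs1 hg hgc))) hφ hφa
  have hae := rieszJ_sub_ae hs0 hn2 hψ hfβ
  have e1 : ∫ p, formIntegrand s (rieszJ s fun y => ψ y - f y) φ p ∂(volume.prod volume)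
      = ∫ p, formIntegrand s (rieszJ s ψ) φ p ∂(volume.prod volume)
        - ∫ p, formIntegrand s (rieszJ s f) φ p ∂(volume.prod volume) := by
    rw [formIntegrand_comm s (rieszJ s ψ), formIntegrand_comm s (rieszJ s f),
      ← integral_formIntegrand_sub_right (by rw [formIntegrand_comm]; exact hint ψ hψ)
        (by rw [formIntegrand_comm]; exact hint f hfβ)]
    refine integral_congr_ae ?_
    filter_upwards [gagQuot_congr_ae s hae] with p hp
    rw [← gagQuot_mul_gagQuot, ← gagQuot_mul_gagQuot, hp, mul_comm]
  have e2 : ∫ x, (ψ x - f x) * φ x = (∫ x, ψ x * φ x) - ∫ x, f x * φ x := by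
    rw [← integral_sub (integrable_mul_of_memLp hs0 hn2 hψ hφ)
      (integrable_mul_of_memLp hs0 hn2 hfβ hφ)]
    simp only [sub_mul]
  have e : ∫ p, formIntegrand s (rieszJ s ψ) φ p ∂(volume.prod volume) - c * ∫ x, ψ x * φ x
      = ∫ p, formIntegrand s (rieszJ s fun y => ψ y - f y) φ p ∂(volume.prod volume)
        - c * ∫ x, (ψ x - f x) * φ x := by
    rw [e1, e2, hf_eq]
    ring
  rw [e, add_mul]
  refine (enorm_sub_le).trans (add_le_add ?_ ?_)
  · refine (enorm_integral_formIntegrand_le (hHLS _ hd).1.1 hφ.1).trans ?_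
    rw [mul_right_comm]
    gcongr
    refine (hC _ hd).trans ?_
    gcongr
  · rw [enorm_mul, mul_assoc]
    gcongr
    refine (enorm_integral_mul_le hs0 hn2 hd.1 hφ.1).trans ?_
    rw [mul_comm]
    gcongr

end FracRiesz

theorem theorem2p2 (n : ℕ) (s : ℝ) (hs0 : 0 < s) (hs1 : s < 1) (hn : 4 * s < (n : ℝ)) :
    ∃ C c : ℝ, 0 < C ∧ 0 < c ∧ ∃ Cδ : ℝ → ℝ, (∀ δ : ℝ, 0 < δ → 0 < Cδ δ) ∧
      ∀ ψ : FracRiesz.Rn n → ℝ, MemLp ψ (FracRiesz.betaExp n s) volume →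
        (∀ᵐ x ∂(volume : Measure (FracRiesz.Rn n)),
          Integrable (FracRiesz.rieszIntegrand s ψ x) volume) ∧
        (MemLp (FracRiesz.rieszJ s ψ) (FracRiesz.critExp n s) volume ∧
          eLpNorm (FracRiesz.rieszJ s ψ) (FracRiesz.critExp n s) volume
            ≤ ENNReal.ofReal C * eLpNorm ψ (FracRiesz.betaExp n s) volume) ∧
        (FracRiesz.MemHdot s (FracRiesz.rieszJ s ψ) ∧
          FracRiesz.gagliardo s (FracRiesz.rieszJ s ψ)
            ≤ ENNReal.ofReal C * eLpNorm ψ (FracRiesz.betaExp n s) volume) ∧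
        FracRiesz.WeaklySolves s (FracRiesz.rieszJ s ψ) (fun x => c * ψ x) ∧
        (∀ δ : ℝ, 0 < δ →
          FracRiesz.unifLocNorm (ENNReal.ofReal ((n : ℝ) / (2 * s) + δ)) ψ < ⊤ →
          MemLp (FracRiesz.rieszJ s ψ) ⊤ volume ∧
          eLpNorm (FracRiesz.rieszJ s ψ) ⊤ volume
            ≤ ENNReal.ofReal (Cδ δ) *
              (FracRiesz.unifLocNorm (ENNReal.ofReal ((n : ℝ) / (2 * s) + δ)) ψ
                + eLpNorm ψ (FracRiesz.betaExp n s) volume)) ∧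
        (MemLp ψ ⊤ volume →
          MemLp (FracRiesz.rieszJ s ψ) ⊤ volume ∧
          eLpNorm (FracRiesz.rieszJ s ψ) ⊤ volume
            ≤ ENNReal.ofReal C *
              (eLpNorm ψ ⊤ volume + eLpNorm ψ (FracRiesz.betaExp n s) volume)) := by
  open FracRiesz in
  have hn2 : 2 * s < n := by linarith
  have hn0 : (0 : ℝ) < n := by linarith
  have : NeZero n := ⟨by rintro rfl; simp at hn0⟩
  obtain ⟨C₁, hC₁, hHLS⟩ := exists_eLpNorm_rieszJ_le (n := n) hs0 hn2
  obtain ⟨c, hc, hcore⟩ := exists_integral_formIntegrand_rieszJ (n := n) hs0 hs1 hn2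
  obtain ⟨C₂, hC₂, hgag⟩ := exists_gagliardo_rieszJ_le hs0 hs1 hn hc hcore
  choose! Cδ hCδ hsup using fun (δ : ℝ) (hδ : 0 < δ) =>
    exists_rieszPot_le_unifLocNorm (n := n) (s := s) (r := (n : ℝ) / (2 * s) + δ) hs0 hn2
      (by linarith)
  set B : ℝ≥0∞ := volume (Metric.ball (0 : Rn n) 1) ^ (1 / ((n : ℝ) / (2 * s) + 1))
  have hB : B ≠ ⊤ := ENNReal.rpow_ne_top_of_nonneg (by positivity) measure_ball_lt_top.ne
  set C₃ := Cδ 1 * (B.toReal + 1)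
  have hC₃ : 0 < C₃ := mul_pos (hCδ 1 one_pos) (by positivity)
  set C := C₁ + C₂ + C₃
  have h1 : C₁ ≤ C := by linarith
  have h2 : C₂ ≤ C := by linarith
  have h3 : C₃ ≤ C := by linarith
  have hsupδ : ∀ ψ : Rn n → ℝ, MemLp ψ (betaExp n s) volume → ∀ δ : ℝ, 0 < δ →
      unifLocNorm (ENNReal.ofReal ((n : ℝ) / (2 * s) + δ)) ψ < ⊤ →
      MemLp (rieszJ s ψ) ⊤ volume ∧ eLpNorm (rieszJ s ψ) ⊤ volume ≤ ENNReal.ofReal (Cδ δ) *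
        (unifLocNorm (ENNReal.ofReal ((n : ℝ) / (2 * s) + δ)) ψ
          + eLpNorm ψ (betaExp n s) volume) := fun ψ hψ δ hδ hfin =>
    eLpNorm_rieszJ_top_le hψ.1 (hsup δ hδ ψ hψ.1)
      (ENNReal.mul_lt_top ENNReal.ofReal_lt_top (ENNReal.add_lt_top.2 ⟨hfin, hψ.2⟩))
  refine ⟨C, c, by positivity, hc, Cδ, hCδ, fun ψ hψ => ?_⟩
  obtain ⟨hJ, hJle⟩ := hHLS ψ hψ
  have hJg := hgag ψ hψ
  refine ⟨ae_integrable_rieszIntegrand hs0 hn2 hψ, ⟨hJ, hJle.trans (by gcongr)⟩,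
    ⟨memHdot_of_hdotApprox hJ (hdotApprox_rieszJ hs0 hs1 hn hgag hψ), hJg.trans (by gcongr)⟩,
    fun φ hφ => ?_, hsupδ ψ hψ, fun hψt => ?_⟩
  · have hφa := hdotApprox_of_memHdot hs0 hs1 hn2 hφ.1
    have hφg := hφa.gagliardo_lt_top hs0 hs1 hφ.1.1.1
    refine ⟨integrable_formIntegrand hJ.1 hφ.1.1.1
      (hJg.trans_lt (ENNReal.mul_lt_top ENNReal.ofReal_lt_top hψ.2)) hφg, ?_, ?_⟩
    · simpa only [mul_assoc] using (integrable_mul_of_memLp hs0 hn2 hψ hφ.1.1).const_mul c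
    · rw [integral_formIntegrand_rieszJ hs0 hs1 hn hcore hgag hψ hφ.1.1 hφa, ← integral_const_mul]
      simp only [mul_assoc]
  · have hr : 0 < (n : ℝ) / (2 * s) + 1 := by positivity
    have hloc := unifLocNorm_le_eLpNorm_top hr hψt.1
    obtain ⟨hm, hle⟩ := hsupδ ψ hψ 1 one_pos
      (hloc.trans_lt (ENNReal.mul_lt_top hψt.2 hB.lt_top))
    refine ⟨hm, hle.trans ?_⟩
    calc _ ≤ ENNReal.ofReal (Cδ 1) * (eLpNorm ψ ⊤ volume * (B + 1)
          + eLpNorm ψ (betaExp n s) volume * (B + 1)) := by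
          gcongr
          · exact hloc.trans (by gcongr; exact le_self_add)
          · exact le_mul_of_one_le_right' le_add_self
      _ = ENNReal.ofReal C₃ * (eLpNorm ψ ⊤ volume + eLpNorm ψ (betaExp n s) volume) := by
          rw [ENNReal.ofReal_mul (hCδ 1 one_pos).le, ENNReal.ofReal_add (by positivity) zero_le_one,
            ENNReal.ofReal_toReal hB, ENNReal.ofReal_one]
          ring
      _ ≤ _ := by gcongr
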